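/- Let $3\le d_1\le d_2\le d_3$, write $\mathbb Z_n=\{0,1,\dots,n-1\}$ (empty for $n\le 0$), $\hat d=d_1-1$, $d^*=d_1-2$, $\omega=e^{2\pi\sqrt{-1}/3}$, and write $|i\,j\,k\rangle=|i\rangle_A|j\rangle_B|k\rangle_C$ for the computational basis states of $\mathbb C^{d_1}\otimes\mathbb C^{d_2}\otimes\mathbb C^{d_3}$. All states are un-normalized. Put $$\begin{aligned} \mathcal A_0&=\{|\hat d\,\hat d\,\hat d\rangle-|d^*\,d^*\,d^*\rangle\},\\ \mathcal A_1&=\{|\hat d\,\hat d\,i\rangle-|(d^*-i)\,i\,\hat d\rangle: i\in\mathbb Z_{\hat d}\},\\ \mathcal A_2&=\{|\hat d\,i\,\hat d\rangle-|i\,\hat d\,(d^*-i)\rangle: i\in\mathbb Z_{\hat d}\},\\ \mathcal A_3&=\{|\hat d\,(d^*-i)\,i\rangle-|i\,\hat d\,\hat d\rangle: i\in\mathbb Z_{\hat d}\},\\ \mathcal A_4&=\{|\hat d\,k\,l\rangle+\omega|k\,l\,\hat d\rangle+\omega^2|l\,\hat d\,k\rangle: k,l\in\mathbb Z_{\hat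 d},\ k+l\ge d_1-1\},\\ \mathcal A_5&=\{|\hat d\,s\,t\rangle+\omega|s\,t\,\hat d\rangle+\omega^2|t\,\hat d\,s\rangle: s,t\in\mathbb Z_{\hat d},\ s+t\le d_1-3\},\\ \mathcal A_6&=\{|\hat d\,i\,(d_1+j)\rangle-|i\,\hat d\,(d_1+j)\rangle: i\in\mathbb Z_{\hat d},\ j\in\mathbb Z_{d_3-d_1}\},\\ \mathcal A_7&=\{|\hat d\,\hat d\,d_1\rangle-|0\,0\,1\rangle\}\ \text{ if } d_1<d_3,\ \text{ and } \mathcal A_7=\emptyset \text{ if } d_1=d_3,\\ \mathcal A_8&=\{|\hat d\,\hat d\,(d_1+1+i)\rangle-|0\,0\,(d_1+i)\rangle: i\in\mathbb Z_{d_3-d_1-1}\},\\ \mathcal A_9&=\{|\hat d\,(d_1+j)\,i\rangle-|i\,(d_1+j)\,\hat d\rangle: i\in\mathbb Z_{\hat d},\ j\in\mathbb Z_{d_2-d_1}\},\\ \mathcal A_{10}&=\{|\hat d\,d_1\,\hat d\rangle-|0\,1\,0\rangle\}\ \text{ if } d_1<d_2,\ \text{ and } \mathcal A_{10}=\emptyset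 \text{ if } d_1=d_2,\\ \mathcal A_{11}&=\{|\hat d\,(d_1+1+i)\,\hat d\rangle-|0\,(d_1+i)\,0\rangle: i\in\mathbb Z_{d_2-d_1-1}\},\\ \mathcal A_{12}&=\{|\hat d\,d_1\,(d_1+i)\rangle-|0\,1\,(d_1+i)\rangle: i\in\mathbb Z_{d_3-d_1}\}\ \text{ if } d_1<d_2,\ \text{ and } \mathcal A_{12}=\emptyset \text{ if } d_1=d_2,\\ \mathcal A_{13}&=\{|\hat d\,(d_1+1+i)\,(d_1+j)\rangle-|0\,(d_1+i)\,(d_1+j)\rangle: i\in\mathbb Z_{d_2-d_1-1},\ j\in\mathbb Z_{d_3-d_1}\},\\ |S\rangle&=\Big(\sum_{i\in\mathbb Z_{d_1}}|i\rangle_A\Big)\Big(\sum_{j\in\mathbb Z_{d_2}}|j\rangle_B\Big)\Big(\sum_{k\in\mathbb Z_{d_3}}|k\rangle_C\Big). \end{aligned}$$ A measurement of a party, given by operators $M_1,\dots,M_r$ on its space with $\sum_m M_m^\dagger M_m=\mathbb I$, is called trivial if every POVM element $M_m^\dagger M_m$ is proportional to the identity. It is orthogonality-preserving for a set of mutually orthogonal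 nonzero states if, for each outcome $m$, the post-measurement states (the images under $M_m$ tensored with the identity of the other party) of distinct members of the set are mutually orthogonal. A set of mutually orthogonal nonzero states in $\mathbb C^{d_1}\otimes\mathbb C^{d_2}\otimes\mathbb C^{d_3}$ is called strongest nonlocal if, for each of the bipartitions $A|BC$, $B|CA$, $C|AB$, each of the two parties can perform only trivial orthogonality-preserving local measurements. Then $\bigcup_{i=0}^{13}\mathcal A_i\cup\{|S\rangle\}$ is a set of mutually orthogonal states with exactly $d_2d_3+1$ elements, and it is strongest nonlocal. Moreover $d_2d_3+1=\max\{d_2d_3,\,d_1d_3,\,d_1d_2\}+1$, and this is the smallest cardinality of a strongest nonlocal set in $\mathbb C^{d_1}\otimes\mathbb C^{d_2}\otimes\mathbb C^{d_3}$ (the tripartite case of the conjecture of Li and Wang). -/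

import Mathlib

open scoped Matrix Kronecker

noncomputable section

namespace Tripartite

/-! ### Local measurements and the strongest nonlocality -/

section Nonlocality

variable {ι X Y : Type} [Fintype ι] [Fintype X] [Fintype Y]
  [DecidableEq ι] [DecidableEq X] [DecidableEq Y]

/-- A set of (un-normalized) pure states: nonzero, mutually orthogonal vectors. -/
def IsOrthogonalSet (S : Set (EuclideanSpace ℂ ι)) : Prop :=
  (0 : EuclideanSpace ℂ ι) ∉ S ∧ S.Pairwise fun Φ Ψ => inner ℂ Φ Ψ = 0

/-- The operator `𝟙 ⊗ M` applied to a state. The bijection `e` of the computational bases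
splits the total system into two parties with bases `X` and `Y`, and `M` acts on party `Y`. -/
def applyLocal (e : ι ≃ X × Y) (M : Matrix Y Y ℂ) (ψ : EuclideanSpace ℂ ι) :
    EuclideanSpace ℂ ι :=
  WithLp.toLp 2 ((((1 : Matrix X X ℂ) ⊗ₖ M).submatrix e e) *ᵥ ψ.ofLp)

/-- A measurement with `r` outcomes, given by its measurement operators `M m`; its POVM elements
are the matrices `(M m)ᴴ * M m`, which sum to the identity. -/
def IsMeasurement {r : ℕ} (M : Fin r → Matrix Y Y ℂ) : Prop :=
  ∑ m, (M m)ᴴ * M m = 1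

/-- A measurement is trivial if all its POVM elements are proportional to the identity. -/
def IsTrivialMeasurement {r : ℕ} (M : Fin r → Matrix Y Y ℂ) : Prop :=
  ∀ m, ∃ c : ℂ, (M m)ᴴ * M m = c • (1 : Matrix Y Y ℂ)

/-- The local measurement `M` of party `Y` preserves the orthogonality of `S`: for every outcome,
the post-measurement states of distinct members of `S` are orthogonal. -/
def PreservesOrthogonality (e : ι ≃ X × Y) (S : Set (EuclideanSpace ℂ ι)) {r : ℕ}
    (M : Fin r → Matrix Y Y ℂ) : Prop :=
  ∀ m, S.Pairwise fun Φ Ψ => inner ℂ (applyLocal e (M m) Φ) (applyLocal e (M m) Ψ) = 0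

/-- Party `Y` can perform only trivial orthogonality-preserving local measurements on `S`. -/
def OnlyTrivialOPLM (e : ι ≃ X × Y) (S : Set (EuclideanSpace ℂ ι)) : Prop :=
  ∀ (r : ℕ) (M : Fin r → Matrix Y Y ℂ),
    IsMeasurement M → PreservesOrthogonality e S M → IsTrivialMeasurement M

/-- Both parties of the bipartition `X | Y` can perform only trivial orthogonality-preserving
local measurements on `S`. -/
def OnlyTrivialOPLMAcross (e : ι ≃ X × Y) (S : Set (EuclideanSpace ℂ ι)) : Prop :=
  OnlyTrivialOPLM e S ∧ OnlyTrivialOPLM (e.trans (Equiv.prodComm X Y)) S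

end Nonlocality

/-- The index set of the computational basis of `ℂ^d₁ ⊗ ℂ^d₂ ⊗ ℂ^d₃`. -/
abbrev Idx (d₁ d₂ d₃ : ℕ) : Type := Fin d₁ × Fin d₂ × Fin d₃

/-- The Hilbert space `ℂ^d₁ ⊗ ℂ^d₂ ⊗ ℂ^d₃`, in coordinates of the computational basis. -/
abbrev H (d₁ d₂ d₃ : ℕ) : Type := EuclideanSpace ℂ (Idx d₁ d₂ d₃)

/-- The bipartition `A | BC`. -/
def splitA (d₁ d₂ d₃ : ℕ) : Idx d₁ d₂ d₃ ≃ Fin d₁ × (Fin d₂ × Fin d₃) :=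
  Equiv.refl _

/-- The bipartition `B | CA`. -/
def splitB (d₁ d₂ d₃ : ℕ) : Idx d₁ d₂ d₃ ≃ Fin d₂ × (Fin d₃ × Fin d₁) where
  toFun p := (p.2.1, (p.2.2, p.1))
  invFun q := (q.2.2, q.1, q.2.1)
  left_inv _ := rfl
  right_inv _ := rfl

/-- The bipartition `C | AB`. -/
def splitC (d₁ d₂ d₃ : ℕ) : Idx d₁ d₂ d₃ ≃ Fin d₃ × (Fin d₁ × Fin d₂) where
  toFun p := (p.2.2, (p.1, p.2.1))
  invFun q := (q.2.1, q.2.2, q.1)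
  left_inv _ := rfl
  right_inv _ := rfl

/-- A set of orthogonal tripartite states is strongest nonlocal if only trivial
orthogonality-preserving local measurements can be performed for each bipartition. -/
def StrongestNonlocal {d₁ d₂ d₃ : ℕ} (S : Set (H d₁ d₂ d₃)) : Prop :=
  IsOrthogonalSet S ∧
  OnlyTrivialOPLMAcross (splitA d₁ d₂ d₃) S ∧
  OnlyTrivialOPLMAcross (splitB d₁ d₂ d₃) S ∧
  OnlyTrivialOPLMAcross (splitC d₁ d₂ d₃) S

/-! ### The states -/

section States

variable (d₁ d₂ d₃ : ℕ)

/-- The basis state `|i⟩_A |j⟩_B |k⟩_C`. It is only ever used with `i < d₁`, `j < d₂`, `k < d₃`. -/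
def ket (i j k : ℕ) : H d₁ d₂ d₃ :=
  WithLp.toLp 2 fun p =>
    if (p.1 : ℕ) = i ∧ (p.2.1 : ℕ) = j ∧ (p.2.2 : ℕ) = k then 1 else 0

/-- The primitive third root of unity `e^{2πi/3}`. -/
def ω₃ : ℂ := Complex.exp (2 * Real.pi * Complex.I / 3)

/-- The W-like state `|i⟩|j⟩|k⟩ + ω₃ |j⟩|k⟩|i⟩ + ω₃² |k⟩|i⟩|j⟩`. -/
def wLike (i j k : ℕ) : H d₁ d₂ d₃ :=
  ket d₁ d₂ d₃ i j k + ω₃ • ket d₁ d₂ d₃ j k i + ω₃ ^ 2 • ket d₁ d₂ d₃ k i j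

/-- The stopper state `(∑ i, |i⟩_A) (∑ j, |j⟩_B) (∑ k, |k⟩_C)`. -/
def stopper : H d₁ d₂ d₃ :=
  ∑ i : Fin d₁, ∑ j : Fin d₂, ∑ k : Fin d₃, ket d₁ d₂ d₃ i j k

def A0 : Set (H d₁ d₂ d₃) :=
  {ket d₁ d₂ d₃ (d₁ - 1) (d₁ - 1) (d₁ - 1) - ket d₁ d₂ d₃ (d₁ - 2) (d₁ - 2) (d₁ - 2)}

def A1 : Set (H d₁ d₂ d₃) :=
  {φ | ∃ i < d₁ - 1,
    φ = ket d₁ d₂ d₃ (d₁ - 1) (d₁ - 1) i - ket d₁ d₂ d₃ (d₁ - 2 - i) i (d₁ - 1)}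

def A2 : Set (H d₁ d₂ d₃) :=
  {φ | ∃ i < d₁ - 1,
    φ = ket d₁ d₂ d₃ (d₁ - 1) i (d₁ - 1) - ket d₁ d₂ d₃ i (d₁ - 1) (d₁ - 2 - i)}

def A3 : Set (H d₁ d₂ d₃) :=
  {φ | ∃ i < d₁ - 1,
    φ = ket d₁ d₂ d₃ (d₁ - 1) (d₁ - 2 - i) i - ket d₁ d₂ d₃ i (d₁ - 1) (d₁ - 1)}

def A4 : Set (H d₁ d₂ d₃) :=
  {φ | ∃ k < d₁ - 1, ∃ l < d₁ - 1, d₁ - 1 ≤ k + l ∧ φ = wLike d₁ d₂ d₃ (d₁ - 1) k l}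

def A5 : Set (H d₁ d₂ d₃) :=
  {φ | ∃ s < d₁ - 1, ∃ t < d₁ - 1, s + t ≤ d₁ - 3 ∧ φ = wLike d₁ d₂ d₃ (d₁ - 1) s t}

def A6 : Set (H d₁ d₂ d₃) :=
  {φ | ∃ i < d₁ - 1, ∃ j < d₃ - d₁,
    φ = ket d₁ d₂ d₃ (d₁ - 1) i (d₁ + j) - ket d₁ d₂ d₃ i (d₁ - 1) (d₁ + j)}

/-- Empty if `d₃ = d₁`, since then `|d₁⟩_C` does not exist. -/
def A7 : Set (H d₁ d₂ d₃) :=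
  {φ | d₁ < d₃ ∧ φ = ket d₁ d₂ d₃ (d₁ - 1) (d₁ - 1) d₁ - ket d₁ d₂ d₃ 0 0 1}

def A8 : Set (H d₁ d₂ d₃) :=
  {φ | ∃ i < d₃ - d₁ - 1,
    φ = ket d₁ d₂ d₃ (d₁ - 1) (d₁ - 1) (d₁ + 1 + i) - ket d₁ d₂ d₃ 0 0 (d₁ + i)}

def A9 : Set (H d₁ d₂ d₃) :=
  {φ | ∃ i < d₁ - 1, ∃ j < d₂ - d₁,
    φ = ket d₁ d₂ d₃ (d₁ - 1) (d₁ + j) i - ket d₁ d₂ d₃ i (d₁ + j) (d₁ - 1)}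

/-- Empty if `d₂ = d₁`, since then `|d₁⟩_B` does not exist. -/
def A10 : Set (H d₁ d₂ d₃) :=
  {φ | d₁ < d₂ ∧ φ = ket d₁ d₂ d₃ (d₁ - 1) d₁ (d₁ - 1) - ket d₁ d₂ d₃ 0 1 0}

def A11 : Set (H d₁ d₂ d₃) :=
  {φ | ∃ i < d₂ - d₁ - 1,
    φ = ket d₁ d₂ d₃ (d₁ - 1) (d₁ + 1 + i) (d₁ - 1) - ket d₁ d₂ d₃ 0 (d₁ + i) 0}

/-- Empty if `d₂ = d₁`, since then `|d₁⟩_B` does not exist. -/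
def A12 : Set (H d₁ d₂ d₃) :=
  {φ | d₁ < d₂ ∧ ∃ i < d₃ - d₁,
    φ = ket d₁ d₂ d₃ (d₁ - 1) d₁ (d₁ + i) - ket d₁ d₂ d₃ 0 1 (d₁ + i)}

def A13 : Set (H d₁ d₂ d₃) :=
  {φ | ∃ i < d₂ - d₁ - 1, ∃ j < d₃ - d₁,
    φ = ket d₁ d₂ d₃ (d₁ - 1) (d₁ + 1 + i) (d₁ + j) - ket d₁ d₂ d₃ 0 (d₁ + i) (d₁ + j)}

/-- The union of the families `A0, …, A13` together with the stopper state. -/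
def nonlocalSet : Set (H d₁ d₂ d₃) :=
  A0 d₁ d₂ d₃ ∪ A1 d₁ d₂ d₃ ∪ A2 d₁ d₂ d₃ ∪ A3 d₁ d₂ d₃ ∪ A4 d₁ d₂ d₃ ∪ A5 d₁ d₂ d₃ ∪
  A6 d₁ d₂ d₃ ∪ A7 d₁ d₂ d₃ ∪ A8 d₁ d₂ d₃ ∪ A9 d₁ d₂ d₃ ∪ A10 d₁ d₂ d₃ ∪ A11 d₁ d₂ d₃ ∪
  A12 d₁ d₂ d₃ ∪ A13 d₁ d₂ d₃ ∪ {stopper d₁ d₂ d₃}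

end States

end Tripartite

end

/-!
The set is studied across each bipartition through its slices: a slice fixes the coordinate of the
single party, and a state is then a family of vectors of the remaining two-party system `Y`. Write
`d₁ = s + 2`. Across `A | BC` every member except the stopper contains exactly one basis state of
slice `s + 1`, and every basis state `(j, k)` of `BC` occurs there exactly once, so that the members
are labelled by the `d₂ * d₃` basis states of `BC` (`nonlocalSet_eq`). This gives the cardinality;
orthogonality holds because no basis state occurs in two labelled states and because the
coefficients of each sum to zero. Across `B | CA` and `C | AB` the states that meet slice `s + 1`
are, up to the scalars `-1`, `ω₃`, `ω₃ ^ 2`, the labelled states of the same combinatorial system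
with other dimensions. The members that avoid the slice (they exist for `C | AB` when `d₁ < d₃` and
for `B | CA` when `d₁ < d₂`) are not needed. Hence one analysis, that of `SliceSystem`, settles the
parties `BC`, `CA` and `AB`. A measurement `M` of a single party is a measurement `M ⊗ 𝟙` of one of
these, so `A`, `B` and `C` follow (`OnlyTrivialOPLM.of_prod`).

Let `E = Mᴴ * M` be a POVM element. Since distinct labels do not interact in slice `s + 1` except
through the entry of `E` at them, preservation of orthogonality expresses each off-diagonal entry of
`E` by the entries between those basis states of the two tails that lie in a common slice
(`eq_zero_of_occurs`). Iterating this, the two labels end up in different slices, and the entry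
vanishes. The only exceptions are the entry at `(s + 1, i)` and `(i, s + 1)` with `2 * i = s`, which
returns to its own negative conjugate, and the entries that lead to it; comparing row sums of `E` by
means of the stopper state removes it (`row_col_middle`). So `E` is diagonal (`off_diagonal`), and
then orthogonality to the stopper makes the real diagonal constant along each labelled state, since
`1 + ω₃ + ω₃ ^ 2 = 0` is the only real relation between the cube roots of unity, up to scaling; the
labelled states link all labels (`diagonal`).

For minimality, `N` states impose `N * (N - 1)` linear conditions on the matrices `E` of a party of
dimension `n`. If `N ≤ n`, the solutions form a space of dimension at least `n ≥ 2`, closed under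
the adjoint, so there is a Hermitian solution `F` that is not a multiple of `𝟙`, and `1 / 2 ± t F`
are the POVM elements of a nontrivial orthogonality-preserving measurement
(`OnlyTrivialOPLM.card_add_one_le_encard`).
-/

namespace Tripartite

/-! ### The form of a local operator -/

section LocalForm

set_option linter.unusedSectionVars false

variable {ι X Y : Type} [Fintype ι] [Fintype X] [Fintype Y]
  [DecidableEq ι] [DecidableEq X] [DecidableEq Y]

/-- The sesquilinear form `(Φ, Ψ) ↦ ⟨Φ, (𝟙 ⊗ E) Ψ⟩` on the states of the total system. -/
noncomputable def localForm (e : ι ≃ X × Y) (E : Matrix Y Y ℂ) :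
    EuclideanSpace ℂ ι →ₗ⋆[ℂ] EuclideanSpace ℂ ι →ₗ[ℂ] ℂ :=
  LinearMap.mk₂'ₛₗ (starRingEnd ℂ) (RingHom.id ℂ)
    (fun Φ Ψ => star Φ.ofLp ⬝ᵥ ((((1 : Matrix X X ℂ) ⊗ₖ E).submatrix e e) *ᵥ Ψ.ofLp))
    (fun Φ Φ' Ψ => by simp [add_dotProduct])
    (fun c Φ Ψ => by simp [smul_dotProduct])
    (fun Φ Ψ Ψ' => by simp [Matrix.mulVec_add])
    (fun c Φ Ψ => by simp [Matrix.mulVec_smul])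

theorem localForm_apply (e : ι ≃ X × Y) (E : Matrix Y Y ℂ) (Φ Ψ : EuclideanSpace ℂ ι) :
    localForm e E Φ Ψ =
      star Φ.ofLp ⬝ᵥ ((((1 : Matrix X X ℂ) ⊗ₖ E).submatrix e e) *ᵥ Ψ.ofLp) := rfl

theorem inner_applyLocal (e : ι ≃ X × Y) (M : Matrix Y Y ℂ) (Φ Ψ : EuclideanSpace ℂ ι) :
    inner ℂ (applyLocal e M Φ) (applyLocal e M Ψ) = localForm e (Mᴴ * M) Φ Ψ := by
  have h : ((1 : Matrix X X ℂ) ⊗ₖ (Mᴴ * M)).submatrix e e =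
      (((1 : Matrix X X ℂ) ⊗ₖ M).submatrix e e)ᴴ * ((1 : Matrix X X ℂ) ⊗ₖ M).submatrix e e := by
    rw [Matrix.conjTranspose_submatrix, Matrix.submatrix_mul_equiv, Matrix.conjTranspose_kronecker,
      ← Matrix.mul_kronecker_mul]
    simp
  rw [localForm_apply, h, ← Matrix.mulVec_mulVec, Matrix.dotProduct_mulVec,
    ← Matrix.star_mulVec, EuclideanSpace.inner_eq_star_dotProduct, dotProduct_comm]
  rfl

theorem localForm_one (e : ι ≃ X × Y) (Φ Ψ : EuclideanSpace ℂ ι) :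
    localForm e 1 Φ Ψ = inner ℂ Φ Ψ := by
  rw [localForm_apply, EuclideanSpace.inner_eq_star_dotProduct, dotProduct_comm]
  simp

theorem localForm_add (e : ι ≃ X × Y) (E F : Matrix Y Y ℂ) (Φ Ψ : EuclideanSpace ℂ ι) :
    localForm e (E + F) Φ Ψ = localForm e E Φ Ψ + localForm e F Φ Ψ := by
  have h : ((1 : Matrix X X ℂ) ⊗ₖ (E + F)).submatrix e e =
      ((1 : Matrix X X ℂ) ⊗ₖ E).submatrix e e + ((1 : Matrix X X ℂ) ⊗ₖ F).submatrix e e := by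
    rw [Matrix.kronecker_add]; rfl
  simp only [localForm_apply, h, Matrix.add_mulVec, dotProduct_add]

theorem localForm_smul (e : ι ≃ X × Y) (c : ℂ) (E : Matrix Y Y ℂ) (Φ Ψ : EuclideanSpace ℂ ι) :
    localForm e (c • E) Φ Ψ = c * localForm e E Φ Ψ := by
  have h : ((1 : Matrix X X ℂ) ⊗ₖ (c • E)).submatrix e e =
      c • ((1 : Matrix X X ℂ) ⊗ₖ E).submatrix e e := by
    rw [Matrix.kronecker_smul]; rfl
  simp only [localForm_apply, h, Matrix.smul_mulVec, dotProduct_smul, smul_eq_mul]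

theorem localForm_conjTranspose (e : ι ≃ X × Y) (E : Matrix Y Y ℂ) (Φ Ψ : EuclideanSpace ℂ ι) :
    localForm e Eᴴ Φ Ψ = star (localForm e E Ψ Φ) := by
  have h : ((1 : Matrix X X ℂ) ⊗ₖ Eᴴ).submatrix e e =
      (((1 : Matrix X X ℂ) ⊗ₖ E).submatrix e e)ᴴ := by
    rw [Matrix.conjTranspose_submatrix, Matrix.conjTranspose_kronecker, Matrix.conjTranspose_one]
  rw [localForm_apply, localForm_apply, h, Matrix.star_dotProduct, Matrix.star_mulVec,
    Matrix.conjTranspose_conjTranspose, ← Matrix.dotProduct_mulVec]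

theorem localForm_single (e : ι ≃ X × Y) (E : Matrix Y Y ℂ) (p q : ι) :
    localForm e E (EuclideanSpace.single p 1) (EuclideanSpace.single q 1) =
      if (e p).1 = (e q).1 then E (e p).2 (e q).2 else 0 := by
  rw [localForm_apply]
  simp [Matrix.kroneckerMap_apply, Matrix.one_apply, EuclideanSpace.single]

/-- The form against the all-ones state sees the row sums of `E`. -/
theorem localForm_single_one (e : ι ≃ X × Y) (E : Matrix Y Y ℂ) (p : ι) :
    localForm e E (EuclideanSpace.single p 1) (WithLp.toLp 2 fun _ => 1) =
      ∑ y, E (e p).2 y := by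
  have h : star (EuclideanSpace.single p (1 : ℂ)).ofLp = Pi.single p 1 := by
    ext q
    simp [Pi.single_apply, apply_ite]
  rw [localForm_apply, h, single_one_dotProduct]
  simp only [Matrix.mulVec, dotProduct, Matrix.submatrix_apply, mul_one]
  rw [Equiv.sum_comp e (fun z => ((1 : Matrix X X ℂ) ⊗ₖ E) (e p) z), Fintype.sum_prod_type]
  simp [Matrix.kroneckerMap_apply, Matrix.one_apply]

/-- Triviality passes from a composite party `P ⊗ Q` to its part `P`, because a measurement `M` of
`P` is the measurement `M ⊗ 𝟙` of the composite party. -/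
theorem OnlyTrivialOPLM.of_prod {P Q Z : Type} [Fintype P] [Fintype Q] [Fintype Z]
    [DecidableEq P] [DecidableEq Q] [DecidableEq Z] [Nonempty Q]
    {S : Set (EuclideanSpace ℂ ι)} (e : ι ≃ X × (P × Q)) (e' : ι ≃ Z × P)
    (h2 : ∀ t, (e' t).2 = (e t).2.1)
    (h1 : ∀ t u, (e' t).1 = (e' u).1 ↔ (e t).1 = (e u).1 ∧ (e t).2.2 = (e u).2.2)
    (h : OnlyTrivialOPLM e S) : OnlyTrivialOPLM e' S := by
  intro r M hM hpres m
  have happ : ∀ N : Matrix P P ℂ, ∀ Φ, applyLocal e (N ⊗ₖ (1 : Matrix Q Q ℂ)) Φ =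
      applyLocal e' N Φ := by
    intro N Φ
    have : ((1 : Matrix X X ℂ) ⊗ₖ (N ⊗ₖ (1 : Matrix Q Q ℂ))).submatrix e e =
        ((1 : Matrix Z Z ℂ) ⊗ₖ N).submatrix e' e' := by
      ext t u
      simp only [Matrix.submatrix_apply, Matrix.kroneckerMap_apply, Matrix.one_apply, h1, h2]
      split_ifs <;> simp_all
    rw [applyLocal, applyLocal, this]
  have hmul : ∀ N : Matrix P P ℂ, (N ⊗ₖ (1 : Matrix Q Q ℂ))ᴴ * (N ⊗ₖ (1 : Matrix Q Q ℂ)) =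
      (Nᴴ * N) ⊗ₖ (1 : Matrix Q Q ℂ) := by
    intro N
    rw [Matrix.conjTranspose_kronecker, ← Matrix.mul_kronecker_mul]
    simp
  obtain ⟨c, hc⟩ := h r (fun m => M m ⊗ₖ (1 : Matrix Q Q ℂ))
    (by
      have hsum : ∑ m, (M m)ᴴ * M m = 1 := hM
      simp only [IsMeasurement, hmul]
      rw [← Matrix.one_kronecker_one, ← hsum]
      ext ⟨a, b⟩ ⟨a', b'⟩
      simp [Matrix.sum_apply, Finset.sum_mul])
    (fun m Φ hΦ Ψ hΨ hne => by simpa only [happ] using hpres m hΦ hΨ hne) m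
  refine ⟨c, ?_⟩
  rw [hmul] at hc
  obtain ⟨q⟩ := ‹Nonempty Q›
  ext a b
  have := congrFun (congrFun hc (a, q)) (b, q)
  simpa [Matrix.one_apply] using this

end LocalForm

/-! ### The lower bound on the number of states -/

section LowerBound

variable {ι X Y : Type} [Fintype ι] [Fintype X] [Fintype Y]
  [DecidableEq ι] [DecidableEq X] [DecidableEq Y]

open scoped MatrixOrder Matrix.Norms.L2Operator in
/-- A Hermitian matrix can be shifted and rescaled to be one POVM element of a measurement with two
outcomes. -/
theorem exists_isMeasurement_of_isHermitian (F : Matrix Y Y ℂ) (hF : F.IsHermitian) :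
    ∃ t : ℂ, t ≠ 0 ∧ ∃ M : Fin 2 → Matrix Y Y ℂ, IsMeasurement M ∧
      (M 0)ᴴ * M 0 = (1 / 2 : ℂ) • 1 + t • F ∧ (M 1)ᴴ * M 1 = (1 / 2 : ℂ) • 1 + (-t) • F := by
  have key : ∀ G : Matrix Y Y ℂ, G.IsHermitian → ‖G‖ ≤ 1 / 2 →
      ∃ M : Matrix Y Y ℂ, Mᴴ * M = (1 / 2 : ℂ) • 1 + G := by
    intro G hG hn
    -- `-‖G‖ ≤ G` in the Loewner order, so `1 / 2 + G` is positive and has a square root.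
    have h0 : (0 : Matrix Y Y ℂ) ≤ (1 / 2 : ℂ) • 1 + G := by
      have h1 := IsSelfAdjoint.neg_algebraMap_norm_le_self (a := G) hG
      have h2 : (algebraMap ℝ (Matrix Y Y ℂ)) ‖G‖ ≤ algebraMap ℝ (Matrix Y Y ℂ) (1 / 2) :=
        algebraMap_mono _ hn
      have h3 : algebraMap ℝ (Matrix Y Y ℂ) (1 / 2) = (1 / 2 : ℂ) • 1 := by
        rw [Algebra.algebraMap_eq_smul_one]
        ext a b
        simp [Matrix.smul_apply]
      rw [← h3]
      have := add_le_add h2 h1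
      simpa using this
    obtain ⟨M, hM⟩ := CStarAlgebra.nonneg_iff_eq_star_mul_self.mp h0
    exact ⟨M, hM.symm⟩
  have hpos : 0 < 2 * (‖F‖ + 1) := by positivity
  set t : ℝ := 1 / (2 * (‖F‖ + 1)) with ht
  have htpos : 0 < t := by positivity
  have hherm : ((t : ℂ) • F).IsHermitian := by
    rw [Matrix.IsHermitian, Matrix.conjTranspose_smul, hF.eq]
    simp
  have hnorm : ‖(t : ℂ) • F‖ ≤ 1 / 2 := by
    rw [norm_smul, Complex.norm_real, Real.norm_of_nonneg htpos.le, ht, div_mul_eq_mul_div,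
      div_le_div_iff₀ hpos two_pos]
    linarith
  obtain ⟨M₀, h₀⟩ := key _ hherm hnorm
  obtain ⟨M₁, h₁⟩ := key (-((t : ℂ) • F)) hherm.neg (by rwa [norm_neg])
  refine ⟨t, by exact_mod_cast htpos.ne', ![M₀, M₁], ?_, by simpa using h₀, by simpa using h₁⟩
  simp only [IsMeasurement, Fin.sum_univ_two, Matrix.cons_val_zero, Matrix.cons_val_one, h₀, h₁]
  rw [add_add_add_comm, add_neg_cancel, add_zero, ← add_smul]
  norm_num

/-- If party `Y` can perform only trivial orthogonality-preserving measurements, then a matrix whose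
form vanishes on all pairs of distinct states is proportional to the identity. -/
theorem OnlyTrivialOPLM.exists_eq_smul_one {e : ι ≃ X × Y} {S : Set (EuclideanSpace ℂ ι)}
    (hS : IsOrthogonalSet S) (h : OnlyTrivialOPLM e S) (E : Matrix Y Y ℂ)
    (hE : S.Pairwise fun Φ Ψ => localForm e E Φ Ψ = 0) : ∃ c : ℂ, E = c • 1 := by
  have herm : ∀ F : Matrix Y Y ℂ, F.IsHermitian →
      (S.Pairwise fun Φ Ψ => localForm e F Φ Ψ = 0) → ∃ c : ℂ, F = c • 1 := by
    intro F hF hpair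
    obtain ⟨t, ht, M, hM, h0, h1⟩ := exists_isMeasurement_of_isHermitian F hF
    have hpres : PreservesOrthogonality e S M := by
      intro m Φ hΦ Ψ hΨ hne
      have h3 : inner ℂ Φ Ψ = 0 := hS.2 hΦ hΨ hne
      have h4 : localForm e F Φ Ψ = 0 := hpair hΦ hΨ hne
      show inner ℂ _ _ = _
      rw [inner_applyLocal]
      fin_cases m
      · simp [h0, localForm_add, localForm_smul, localForm_one, h3, h4]
      · simp only [Fin.mk_one, Fin.isValue, h1, localForm_add, localForm_smul, localForm_one, h3, h4]
        simp
    obtain ⟨c, hc⟩ := h 2 M hM hpres 0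
    rw [h0] at hc
    refine ⟨t⁻¹ * (c - 1 / 2), ?_⟩
    rw [mul_smul, sub_smul, ← hc, add_sub_cancel_left, smul_smul, inv_mul_cancel₀ ht, one_smul]
  have hE' : S.Pairwise fun Φ Ψ => localForm e Eᴴ Φ Ψ = 0 := by
    intro Φ hΦ Ψ hΨ hne
    show localForm e Eᴴ Φ Ψ = 0
    rw [localForm_conjTranspose, show localForm e E Ψ Φ = 0 from hE hΨ hΦ hne.symm, star_zero]
  -- Split `E` into its Hermitian and anti-Hermitian parts.
  obtain ⟨a, ha⟩ := herm (E + Eᴴ) (by simp [Matrix.IsHermitian, add_comm]) (by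
    intro Φ hΦ Ψ hΨ hne
    show localForm e _ Φ Ψ = 0
    rw [localForm_add, show localForm e E Φ Ψ = 0 from hE hΦ hΨ hne,
      show localForm e Eᴴ Φ Ψ = 0 from hE' hΦ hΨ hne, add_zero])
  obtain ⟨b, hb⟩ := herm (Complex.I • (E + (-1 : ℂ) • Eᴴ))
    (by
      simp only [Matrix.IsHermitian, Matrix.conjTranspose_smul, Matrix.conjTranspose_add,
        Matrix.conjTranspose_conjTranspose, smul_add, smul_smul]
      simp [add_comm])
    (by
      intro Φ hΦ Ψ hΨ hne
      show localForm e _ Φ Ψ = 0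
      rw [localForm_smul, localForm_add, localForm_smul,
        show localForm e E Φ Ψ = 0 from hE hΦ hΨ hne,
        show localForm e Eᴴ Φ Ψ = 0 from hE' hΦ hΨ hne]
      simp)
  refine ⟨(1 / 2) * (a - Complex.I * b), ?_⟩
  have hI : E + (-1 : ℂ) • Eᴴ = (-Complex.I * b) • 1 := by
    rw [mul_smul, ← hb, smul_smul]
    simp
  have : (2 : ℂ) • E = (a - Complex.I * b) • 1 := by
    rw [sub_eq_add_neg, ← neg_mul, add_smul, ← ha, ← hI, two_smul]
    simp only [neg_smul, one_smul]
    abel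
  rw [mul_smul, ← this, smul_smul]
  norm_num

/-- A set on which party `Y` can perform only trivial orthogonality-preserving measurements has more
than `dim Y` elements: the `N (N - 1)` linear conditions imposed by `N ≤ dim Y` states leave a
space of matrices of dimension at least `dim Y ≥ 2`, which is more than the multiples of `𝟙`. -/
theorem OnlyTrivialOPLM.card_add_one_le_encard {e : ι ≃ X × Y} {S : Set (EuclideanSpace ℂ ι)}
    (hS : IsOrthogonalSet S) (h : OnlyTrivialOPLM e S) (hY : 2 ≤ Fintype.card Y) :
    ((Fintype.card Y + 1 : ℕ) : ℕ∞) ≤ S.encard := by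
  by_contra hlt
  rw [not_le] at hlt
  have hfin : S.Finite := Set.finite_of_encard_le_coe hlt.le
  classical
  obtain ⟨T, rfl⟩ := hfin.exists_finset_coe
  rw [Set.encard_coe_eq_coe_finsetCard] at hlt
  have hcard : T.card ≤ Fintype.card Y := by
    have : T.card < Fintype.card Y + 1 := by exact_mod_cast hlt
    omega
  -- `L E` lists the values of the form of `E` on all ordered pairs of distinct states.
  let L : Matrix Y Y ℂ →ₗ[ℂ] (T.offDiag → ℂ) :=
    { toFun := fun E p => localForm e E p.1.1 p.1.2
      map_add' := fun E F => by ext p; simp [localForm_add]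
      map_smul' := fun c E => by ext p; simp [localForm_smul] }
  have hker : LinearMap.ker L ≤ Submodule.span ℂ {(1 : Matrix Y Y ℂ)} := by
    intro E hE
    obtain ⟨c, rfl⟩ := h.exists_eq_smul_one hS E (by
      intro Φ hΦ Ψ hΨ hne
      exact congrFun (LinearMap.mem_ker.mp hE) ⟨(Φ, Ψ), Finset.mem_offDiag.mpr ⟨hΦ, hΨ, hne⟩⟩)
    exact Submodule.smul_mem _ _ (Submodule.mem_span_singleton_self _)
  have h1 : Module.finrank ℂ (LinearMap.ker L) ≤ 1 :=
    (Submodule.finrank_mono hker).trans ((finrank_span_le_card _).trans (by simp))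
  have h2 := L.finrank_range_add_finrank_ker
  have h3 : Module.finrank ℂ (LinearMap.range L) ≤ T.card * T.card - T.card := by
    refine (Submodule.finrank_le _).trans ?_
    rw [Module.finrank_fintype_fun_eq_card, Fintype.card_coe, Finset.offDiag_card]
  rw [Module.finrank_matrix, Module.finrank_self, mul_one] at h2
  set n := Fintype.card Y
  set N := T.card
  have h4 : N * N - N ≤ n * n - n := by
    rw [← Nat.mul_sub_one, ← Nat.mul_sub_one]
    exact Nat.mul_le_mul hcard (by omega)
  have h5 : n ≤ n * n := Nat.le_mul_self n
  omega

end LowerBound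

/-! ### Labelled states and the equations of an orthogonality-preserving measurement -/

section SliceSystem

/-- The index with which the families for `k ≥ d₁ = s + 2` continue inside slice `0`: `d₁` is sent to
`1`, every larger `k` to `k - 1`. -/
def shift (s k : ℕ) : ℕ := if k = s + 2 then 1 else k - 1

variable {V : Type*} [AddCommGroup V] [Module ℂ V]

/-- For `d₁ = s + 2`, the part outside of slice `d₁ - 1 = s + 1` of the state that contains
`|s + 1; j, k⟩`. Here `K a j k` stands for the basis state whose slice index (the coordinate of the
small party of the bipartition) is `a` and whose other two coordinates are `j` and `k`. -/
noncomputable def tail (s : ℕ) (K : ℕ → ℕ → ℕ → V) (j k : ℕ) : V :=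
  if j < s + 1 then
    if k < s + 1 then
      if j + k = s then -K k (s + 1) (s + 1)
      else ω₃ • K j k (s + 1) + ω₃ ^ 2 • K k (s + 1) j
    else if k = s + 1 then -K j (s + 1) (s - j)
    else -K j (s + 1) k
  else if j = s + 1 then
    if k < s + 1 then -K (s - k) k (s + 1)
    else if k = s + 1 then -K s s s
    else -K 0 0 (shift s k)
  else
    if k < s + 1 then -K k j (s + 1)
    else if k = s + 1 then -K 0 (shift s j) 0
    else -K 0 (shift s j) k

/-- The state labelled by `(j, k)`: it is the only one that contains the basis state
`|s + 1; j, k⟩`. -/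
noncomputable def labelled (s : ℕ) (K : ℕ → ℕ → ℕ → V) (j k : ℕ) : V :=
  K (s + 1) j k + tail s K j k

/-- `Occurs s a x y j k`: the basis state `|a; x, y⟩` occurs in `tail s K j k`. -/
def Occurs (s a x y j k : ℕ) : Prop :=
  if j < s + 1 then
    if k < s + 1 then
      if j + k = s then a = k ∧ x = s + 1 ∧ y = s + 1
      else (a = j ∧ x = k ∧ y = s + 1) ∨ (a = k ∧ x = s + 1 ∧ y = j)
    else if k = s + 1 then a = j ∧ x = s + 1 ∧ y + j = s
    else a = j ∧ x = s + 1 ∧ y = k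
  else if j = s + 1 then
    if k < s + 1 then a + k = s ∧ x = k ∧ y = s + 1
    else if k = s + 1 then a = s ∧ x = s ∧ y = s
    else a = 0 ∧ x = 0 ∧ (k = s + 2 ∧ y = 1 ∨ s + 2 < k ∧ y + 1 = k)
  else
    if k < s + 1 then a = k ∧ x = j ∧ y = s + 1
    else if k = s + 1 then a = 0 ∧ (j = s + 2 ∧ x = 1 ∨ s + 2 < j ∧ x + 1 = j) ∧ y = 0
    else a = 0 ∧ (j = s + 2 ∧ x = 1 ∨ s + 2 < j ∧ x + 1 = j) ∧ y = k

theorem shift_spec {s k : ℕ} (hk : s + 1 < k) :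
    k = s + 2 ∧ shift s k = 1 ∨ s + 2 < k ∧ shift s k + 1 = k := by
  unfold shift
  split_ifs <;> omega

theorem tail_mem_span (s : ℕ) (K : ℕ → ℕ → ℕ → V) (j k : ℕ) :
    tail s K j k ∈ Submodule.span ℂ {v | ∃ a x y, Occurs s a x y j k ∧ v = K a x y} := by
  have mem : ∀ a x y, Occurs s a x y j k →
      K a x y ∈ Submodule.span ℂ {v | ∃ a x y, Occurs s a x y j k ∧ v = K a x y} :=
    fun a x y h => Submodule.subset_span ⟨a, x, y, h, rfl⟩
  unfold tail
  split_ifs with h1 h2 h3 h3 h4 h5 h6 h7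
  case pos =>
    refine Submodule.neg_mem _ (mem _ _ _ ?_)
    simp [Occurs, h1, h2, h3]
  case neg =>
    refine Submodule.add_mem _ (Submodule.smul_mem _ _ (mem _ _ _ ?_))
      (Submodule.smul_mem _ _ (mem _ _ _ ?_)) <;> simp [Occurs, h1, h2, h3]
  all_goals
    refine Submodule.neg_mem _ (mem _ _ _ ?_)
    have := @shift_spec s j
    have := @shift_spec s k
    unfold Occurs
    split_ifs
    omega

/-- A sesquilinear form that vanishes on two sets vanishes on their spans. -/
theorem sesqForm_eq_zero_of_mem_span (B : V →ₗ⋆[ℂ] V →ₗ[ℂ] ℂ) {A A' : Set V}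
    (h : ∀ u ∈ A, ∀ v ∈ A', B u v = 0) {x y : V} (hx : x ∈ Submodule.span ℂ A)
    (hy : y ∈ Submodule.span ℂ A') : B x y = 0 := by
  refine Submodule.span_induction (p := fun u _ => B u y = 0) (fun u hu => ?_) (by simp)
    (fun u v _ _ hu hv => by rw [map_add, LinearMap.add_apply, hu, hv, add_zero])
    (fun c v _ hv => by rw [LinearMap.map_smulₛₗ, LinearMap.smul_apply, hv, smul_zero]) hx
  exact Submodule.span_induction (p := fun v _ => B u v = 0) (fun v hv => h u hu v hv)
    (map_zero _) (fun u v _ _ hu hv => by rw [map_add, hu, hv, add_zero])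
    (fun c v _ hv => by rw [map_smul, hv, smul_zero]) hy

theorem Occurs.slice_le {s a x y j k : ℕ} (h : Occurs s a x y j k) : a ≤ s := by
  unfold Occurs at h
  split_ifs at h <;> omega

/-- The conditions that an orthogonality-preserving measurement of a two-party subsystem, with
computational basis `{(j, k) : j < p, k < q}` and POVM element `E`, has to satisfy on the states
`labelled s K j k` and the stopper state `S`. The form `B` is `localForm` for `E`. -/
structure SliceSystem (s p q : ℕ) (B : V →ₗ⋆[ℂ] V →ₗ[ℂ] ℂ) (K : ℕ → ℕ → ℕ → V)
    (E : ℕ → ℕ → ℕ → ℕ → ℂ) (S : V) : Prop where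
  /-- This is `3 ≤ d₁`. -/
  pos : 1 ≤ s
  le_left : s + 2 ≤ p
  le_right : s + 2 ≤ q
  form_same : ∀ a j k j' k', a < s + 2 → B (K a j k) (K a j' k') = E j k j' k'
  form_ne : ∀ a j k a' j' k', a ≠ a' → B (K a j k) (K a' j' k') = 0
  herm : ∀ j k j' k', E j' k' j k = starRingEnd ℂ (E j k j' k')
  pair : ∀ j k j' k', j < p → k < q → j' < p → k' < q → ¬(j = j' ∧ k = k') →
    B (labelled s K j k) (labelled s K j' k') = 0
  row : ∀ a j k, a < s + 2 → j < p → k < q →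
    B (K a j k) S = ∑ z ∈ Finset.range p ×ˢ Finset.range q, E j k z.1 z.2
  form_labelled_stopper : ∀ j k, j < p → k < q → B (labelled s K j k) S = 0

namespace SliceSystem

variable {s p q : ℕ} {B : V →ₗ⋆[ℂ] V →ₗ[ℂ] ℂ} {K : ℕ → ℕ → ℕ → V}
  {E : ℕ → ℕ → ℕ → ℕ → ℂ} {S : V}

theorem symm (h : SliceSystem s p q B K E S) {j k j' k' : ℕ} (h0 : E j k j' k' = 0) :
    E j' k' j k = 0 := by
  rw [h.herm, h0, map_zero]

theorem form_tail_tail (h : SliceSystem s p q B K E S) {j k j' k' : ℕ}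
    (hj : j < p) (hk : k < q) (hj' : j' < p) (hk' : k' < q) (hne : ¬(j = j' ∧ k = k')) :
    E j k j' k' + B (tail s K j k) (tail s K j' k') = 0 := by
  have h1 : B (K (s + 1) j k) (tail s K j' k') = 0 := by
    refine sesqForm_eq_zero_of_mem_span B (A := {K (s + 1) j k}) ?_
      (Submodule.mem_span_singleton_self _) (tail_mem_span s K j' k')
    rintro _ rfl _ ⟨a, x, y, hocc, rfl⟩
    have := hocc.slice_le
    exact h.form_ne _ _ _ _ _ _ (by omega)
  have h2 : B (tail s K j k) (K (s + 1) j' k') = 0 := by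
    refine sesqForm_eq_zero_of_mem_span B (A' := {K (s + 1) j' k'}) ?_
      (tail_mem_span s K j k) (Submodule.mem_span_singleton_self _)
    rintro _ ⟨a, x, y, hocc, rfl⟩ _ rfl
    have := hocc.slice_le
    exact h.form_ne _ _ _ _ _ _ (by omega)
  have h3 := h.pair j k j' k' hj hk hj' hk' hne
  rw [labelled, labelled, map_add, map_add, LinearMap.add_apply, LinearMap.add_apply, h1, h2,
    h.form_same _ _ _ _ _ (by omega)] at h3
  simpa using h3

/-- An off-diagonal entry of `E` vanishes as soon as the entries between the basis states that occur
in a common slice of the two tails vanish. -/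
theorem eq_zero_of_occurs (h : SliceSystem s p q B K E S) {j k j' k' : ℕ}
    (hj : j < p) (hk : k < q) (hj' : j' < p) (hk' : k' < q) (hne : ¬(j = j' ∧ k = k'))
    (hocc : ∀ a x y x' y', Occurs s a x y j k → Occurs s a x' y' j' k' → E x y x' y' = 0) :
    E j k j' k' = 0 := by
  have h1 : B (tail s K j k) (tail s K j' k') = 0 := by
    refine sesqForm_eq_zero_of_mem_span B ?_ (tail_mem_span s K j k) (tail_mem_span s K j' k')
    rintro _ ⟨a, x, y, ho, rfl⟩ _ ⟨a', x', y', ho', rfl⟩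
    by_cases ha : a = a'
    · subst ha
      have := ho.slice_le
      rw [h.form_same _ _ _ _ _ (by omega), hocc a x y x' y' ho ho']
    · exact h.form_ne _ _ _ _ _ _ ha
  simpa [h1] using h.form_tail_tail hj hk hj' hk' hne

end SliceSystem

/-! Occurrences in the tails of the single types of labels. -/

theorem occurs_row {s a x y i : ℕ} (hi : i ≤ s) :
    Occurs s a x y (s + 1) i ↔ a + i = s ∧ x = i ∧ y = s + 1 := by
  unfold Occurs; split_ifs <;> omega

theorem occurs_col {s a x y i : ℕ} (hi : i ≤ s) :
    Occurs s a x y i (s + 1) ↔ a = i ∧ x = s + 1 ∧ y + i = s := by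
  unfold Occurs; split_ifs <;> omega

theorem occurs_corner {s a x y : ℕ} :
    Occurs s a x y (s + 1) (s + 1) ↔ a = s ∧ x = s ∧ y = s := by
  unfold Occurs; split_ifs <;> omega

theorem occurs_row_large {s a x y k : ℕ} (hk : s + 1 < k) :
    Occurs s a x y (s + 1) k ↔
      a = 0 ∧ x = 0 ∧ (k = s + 2 ∧ y = 1 ∨ s + 2 < k ∧ y + 1 = k) := by
  unfold Occurs; split_ifs <;> omega

theorem occurs_col_large {s a x y j : ℕ} (hj : s + 1 < j) :
    Occurs s a x y j (s + 1) ↔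
      a = 0 ∧ (j = s + 2 ∧ x = 1 ∨ s + 2 < j ∧ x + 1 = j) ∧ y = 0 := by
  unfold Occurs; split_ifs <;> omega

theorem occurs_large_large {s a x y j k : ℕ} (hj : s + 1 < j) (hk : s + 1 < k) :
    Occurs s a x y j k ↔
      a = 0 ∧ (j = s + 2 ∧ x = 1 ∨ s + 2 < j ∧ x + 1 = j) ∧ y = k := by
  unfold Occurs; split_ifs <;> omega

theorem occurs_zero_left {s a x y k : ℕ} :
    Occurs s a x y 0 k → k ≠ s + 1 →
      (s + 1 < k ∧ a = 0 ∧ x = s + 1 ∧ y = k) ∨ (k = s ∧ a = s ∧ x = s + 1 ∧ y = s + 1) ∨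
      (k < s ∧ (a = 0 ∧ x = k ∧ y = s + 1 ∨ a = k ∧ x = s + 1 ∧ y = 0)) := by
  unfold Occurs; split_ifs <;> omega

theorem occurs_zero_right {s a x y j : ℕ} :
    Occurs s a x y j 0 → j ≠ s + 1 →
      (s + 1 < j ∧ a = 0 ∧ x = j ∧ y = s + 1) ∨ (j = s ∧ a = 0 ∧ x = s + 1 ∧ y = s + 1) ∨
      (j < s ∧ (a = j ∧ x = 0 ∧ y = s + 1 ∨ a = 0 ∧ x = s + 1 ∧ y = j)) := by
  unfold Occurs; split_ifs <;> omega

/-- The tail of a label with a coordinate below `s + 1` lies in the cross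
`{x = s + 1} ∪ {y = s + 1}`. -/
theorem Occurs.cross {s a x y j k : ℕ} (h : Occurs s a x y j k) (hl : j ≤ s ∨ k ≤ s) :
    x = s + 1 ∨ y = s + 1 := by
  unfold Occurs at h; split_ifs at h <;> omega

theorem Occurs.lt {s a x y j k p q : ℕ} (h : Occurs s a x y j k) (hs : 1 ≤ s) (hp : s + 2 ≤ p)
    (hq : s + 2 ≤ q) (hj : j < p) (hk : k < q) : x < p ∧ y < q := by
  unfold Occurs at h; split_ifs at h <;> omega

/-- Every basis state occurs in the tail of at most one label. -/
theorem Occurs.unique {s a x y j k j' k' : ℕ} (hs : 1 ≤ s) (h : Occurs s a x y j k)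
    (h' : Occurs s a x y j' k') : j = j' ∧ k = k' := by
  unfold Occurs at h h'
  split_ifs at h <;> split_ifs at h' <;> omega

end SliceSystem

/-! ### The off-diagonal entries vanish -/

section Vanishing

variable {V : Type*} [AddCommGroup V] [Module ℂ V] {s p q : ℕ} {B : V →ₗ⋆[ℂ] V →ₗ[ℂ] ℂ}
  {K : ℕ → ℕ → ℕ → V} {E : ℕ → ℕ → ℕ → ℕ → ℂ} {S : V}

namespace SliceSystem

/-! The labels `(s + 1, k)` form the row and the labels `(j, s + 1)` the column of the cross, which
meet in the corner `(s + 1, s + 1)`. Indices above `s + 1` are large. In the lemmas below, the entry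
between two labels is traced through the common slices of their tails until the slices differ. -/

theorem row_row (h : SliceSystem s p q B K E S) {i k : ℕ} (hi : i ≤ s) (hk : k ≤ s) (hne : i ≠ k) :
    E (s + 1) i (s + 1) k = 0 := by
  have := h.le_left; have := h.le_right
  refine h.eq_zero_of_occurs (by omega) (by omega) (by omega) (by omega) (by omega)
    fun a x y x' y' h1 h2 => ?_
  rw [occurs_row hi] at h1
  rw [occurs_row hk] at h2
  omega

theorem col_col (h : SliceSystem s p q B K E S) {i k : ℕ} (hi : i ≤ s) (hk : k ≤ s) (hne : i ≠ k) :
    E i (s + 1) k (s + 1) = 0 := by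
  have := h.le_left; have := h.le_right
  refine h.eq_zero_of_occurs (by omega) (by omega) (by omega) (by omega) (by omega)
    fun a x y x' y' h1 h2 => ?_
  rw [occurs_col hi] at h1
  rw [occurs_col hk] at h2
  omega

theorem row_col_of_ne (h : SliceSystem s p q B K E S) {i k : ℕ} (hi : i ≤ s) (hk : k ≤ s)
    (hne : ¬(i = k ∧ 2 * i = s)) : E (s + 1) i k (s + 1) = 0 := by
  have := h.le_left; have := h.le_right
  refine h.eq_zero_of_occurs (by omega) (by omega) (by omega) (by omega) (by omega)
    fun a x y x' y' h1 h2 => ?_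
  rw [occurs_row hi] at h1
  rw [occurs_col hk] at h2
  obtain ⟨h1, rfl, rfl⟩ := h1
  obtain ⟨h2, rfl, h3⟩ := h2
  obtain rfl : x = y' := by omega
  refine h.eq_zero_of_occurs (by omega) (by omega) (by omega) (by omega) (by omega)
    fun a x y x' y' h1 h2 => ?_
  rw [occurs_col hi] at h1
  rw [occurs_row hi] at h2
  omega

theorem corner_row (h : SliceSystem s p q B K E S) {i : ℕ} (hi : i ≤ s) :
    E (s + 1) (s + 1) (s + 1) i = 0 := by
  have := h.le_left; have := h.le_right; have := h.pos
  refine h.eq_zero_of_occurs (by omega) (by omega) (by omega) (by omega) (by omega)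
    fun a x y x' y' h1 h2 => ?_
  rw [occurs_corner] at h1
  rw [occurs_row hi] at h2
  obtain ⟨rfl, rfl, rfl⟩ := h1
  obtain ⟨h2, rfl, rfl⟩ := h2
  refine h.eq_zero_of_occurs (by omega) (by omega) (by omega) (by omega) (by omega)
    fun a x y x' y' h1 h2 => ?_
  rw [occurs_col hi] at h2
  unfold Occurs at h1
  split_ifs at h1 <;> omega

theorem corner_col (h : SliceSystem s p q B K E S) {i : ℕ} (hi : i ≤ s) :
    E (s + 1) (s + 1) i (s + 1) = 0 := by
  have := h.le_left; have := h.le_right; have := h.pos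
  refine h.eq_zero_of_occurs (by omega) (by omega) (by omega) (by omega) (by omega)
    fun a x y x' y' h1 h2 => ?_
  rw [occurs_corner] at h1
  rw [occurs_col hi] at h2
  obtain ⟨_, _, _⟩ := h1
  obtain ⟨_, _, h2⟩ := h2
  subst a x y x'
  obtain ⟨rfl, rfl⟩ : i = s ∧ y' = 0 := by omega
  refine h.eq_zero_of_occurs (by omega) (by omega) (by omega) (by omega) (by omega)
    fun b x y x' y' h1 h2 => ?_
  rw [occurs_row (by omega)] at h2
  obtain ⟨h2, rfl, rfl⟩ := h2
  have : (x = i ∧ y = i + 1) ∨ (x = i + 1 ∧ y = i) := by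
    unfold Occurs at h1
    split_ifs at h1 <;> omega
  obtain ⟨rfl, rfl⟩ | ⟨rfl, rfl⟩ := this
  · exact h.col_col le_rfl (by omega) (by omega)
  · exact h.row_col_of_ne le_rfl (by omega) (by omega)

theorem row_corner_of_large (h : SliceSystem s p q B K E S) {k : ℕ} (hk : s + 1 < k) (hkq : k < q) :
    E (s + 1) k (s + 1) (s + 1) = 0 := by
  have := h.le_left; have := h.le_right; have := h.pos
  refine h.eq_zero_of_occurs (by omega) (by omega) (by omega) (by omega) (by omega)
    fun a x y x' y' h1 h2 => ?_
  rw [occurs_row_large hk] at h1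
  rw [occurs_corner] at h2
  omega

theorem row_col_of_large (h : SliceSystem s p q B K E S) {k i : ℕ} (hk : s + 1 < k) (hkq : k < q)
    (hi : i ≤ s) : E (s + 1) k i (s + 1) = 0 := by
  have := h.le_left; have := h.le_right; have := h.pos
  refine h.eq_zero_of_occurs (by omega) (by omega) (by omega) (by omega) (by omega)
    fun a x y x' y' h1 h2 => ?_
  rw [occurs_row_large hk] at h1
  rw [occurs_col hi] at h2
  obtain ⟨rfl, rfl, h1⟩ := h1
  obtain ⟨rfl, rfl, h2⟩ := h2
  obtain rfl : s = y' := by omega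
  refine h.eq_zero_of_occurs (by omega) (by omega) (by omega) (by omega) (by omega)
    fun b x y x' y' h3 h4 => ?_
  rw [occurs_row le_rfl] at h4
  obtain ⟨h4, rfl, rfl⟩ := h4
  obtain rfl : b = 0 := by omega
  obtain ⟨h5, -, rfl, rfl⟩ | h5 | ⟨h5, ⟨-, rfl, rfl⟩ | h6⟩ := occurs_zero_left h3 (by omega)
  · refine h.eq_zero_of_occurs (by omega) (by omega) (by omega) (by omega) (by omega)
      fun b x y x' y' h3 h4 => ?_
    rw [occurs_row_large h5] at h3
    rw [occurs_col le_rfl] at h4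
    omega
  · omega
  · exact h.col_col (by omega) le_rfl (by omega)
  · omega

theorem row_row_of_large_left (h : SliceSystem s p q B K E S) {k i : ℕ} (hk : s + 1 < k)
    (hkq : k < q) (hi : i ≤ s) : E (s + 1) k (s + 1) i = 0 := by
  have := h.le_left; have := h.le_right; have := h.pos
  refine h.eq_zero_of_occurs (by omega) (by omega) (by omega) (by omega) (by omega)
    fun a x y x' y' h1 h2 => ?_
  rw [occurs_row_large hk] at h1
  rw [occurs_row hi] at h2
  obtain ⟨rfl, rfl, h1⟩ := h1
  obtain ⟨h2, rfl, rfl⟩ := h2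
  obtain rfl : x' = s := by omega
  refine h.eq_zero_of_occurs (by omega) (by omega) (by omega) (by omega) (by omega)
    fun b x y x' y' h3 h4 => ?_
  rw [occurs_col le_rfl] at h4
  obtain ⟨rfl, rfl, h4⟩ := h4
  obtain rfl : y' = 0 := by omega
  obtain h5 | ⟨-, -, rfl, rfl⟩ | h5 := occurs_zero_left h3 (by omega)
  · omega
  · exact h.corner_row (by omega)
  · omega

theorem row_row_of_large (h : SliceSystem s p q B K E S) {k : ℕ} (hk : s + 1 < k) (hkq : k < q)
    {l : ℕ} (hl : s + 1 < l) (hlq : l < q) (hne : k ≠ l) : E (s + 1) k (s + 1) l = 0 := by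
  induction k using Nat.strong_induction_on generalizing l with
  | _ k ih =>
  have := h.le_left; have := h.le_right; have := h.pos
  refine h.eq_zero_of_occurs (by omega) (by omega) (by omega) (by omega) (by omega)
    fun a x y x' y' h1 h2 => ?_
  rw [occurs_row_large hk] at h1
  rw [occurs_row_large hl] at h2
  obtain ⟨rfl, rfl, h1⟩ := h1
  obtain ⟨-, rfl, h2⟩ := h2
  refine h.eq_zero_of_occurs (by omega) (by omega) (by omega) (by omega) (by omega)
    fun b x₁ y₁ x₂ y₂ h3 h4 => ?_
  obtain ⟨h5, rfl, rfl, rfl⟩ | h5 | ⟨h5, h5'⟩ := occurs_zero_left h3 (by omega) <;>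
  obtain ⟨h6, h7, rfl, rfl⟩ | h6 | ⟨h6, h6'⟩ := occurs_zero_left h4 (by omega)
  · exact ih _ (by omega) h5 (by omega) h6 (by omega) (by omega)
  · omega
  · obtain ⟨rfl, rfl⟩ : x₂ = 1 ∧ y₂ = s + 1 := by omega
    exact h.row_col_of_large h5 (by omega) (by omega)
  · omega
  · omega
  · omega
  · obtain ⟨rfl, rfl⟩ : x₁ = 1 ∧ y₁ = s + 1 := by omega
    exact h.symm (h.row_col_of_large h6 (by omega) (by omega))
  · omega
  · omega

theorem col_corner_of_large (h : SliceSystem s p q B K E S) {j : ℕ} (hj : s + 1 < j) (hjp : j < p) :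
    E j (s + 1) (s + 1) (s + 1) = 0 := by
  have := h.le_left; have := h.le_right; have := h.pos
  refine h.eq_zero_of_occurs (by omega) (by omega) (by omega) (by omega) (by omega)
    fun a x y x' y' h1 h2 => ?_
  rw [occurs_col_large hj] at h1
  rw [occurs_corner] at h2
  omega

theorem col_col_of_large_left (h : SliceSystem s p q B K E S) {j i : ℕ} (hj : s + 1 < j)
    (hjp : j < p) (hi : i ≤ s) : E j (s + 1) i (s + 1) = 0 := by
  have := h.le_left; have := h.le_right; have := h.pos
  refine h.eq_zero_of_occurs (by omega) (by omega) (by omega) (by omega) (by omega)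
    fun a x y x' y' h1 h2 => ?_
  rw [occurs_col_large hj] at h1
  rw [occurs_col hi] at h2
  obtain ⟨rfl, h1, rfl⟩ := h1
  obtain ⟨rfl, rfl, h2⟩ := h2
  obtain rfl : s = y' := by omega
  refine h.eq_zero_of_occurs (by omega) (by omega) (by omega) (by omega) (by omega)
    fun b x y x' y' h3 h4 => ?_
  rw [occurs_row le_rfl] at h4
  obtain ⟨h4, rfl, rfl⟩ := h4
  obtain rfl : b = 0 := by omega
  obtain ⟨h5, -, rfl, rfl⟩ | ⟨-, -, rfl, rfl⟩ | ⟨h5, h6 | ⟨-, rfl, rfl⟩⟩ :=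
    occurs_zero_right h3 (by omega)
  · refine h.eq_zero_of_occurs (by omega) (by omega) (by omega) (by omega) (by omega)
      fun b x y x' y' h3 h4 => ?_
    rw [occurs_col_large h5] at h3
    rw [occurs_col le_rfl] at h4
    omega
  · exact h.corner_col le_rfl
  · omega
  · exact h.row_col_of_ne (by omega) le_rfl (by omega)

theorem col_row_of_large_left (h : SliceSystem s p q B K E S) {j i : ℕ} (hj : s + 1 < j)
    (hjp : j < p) (hi : i ≤ s) : E j (s + 1) (s + 1) i = 0 := by
  have := h.le_left; have := h.le_right; have := h.pos
  refine h.eq_zero_of_occurs (by omega) (by omega) (by omega) (by omega) (by omega)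
    fun a x y x' y' h1 h2 => ?_
  rw [occurs_col_large hj] at h1
  rw [occurs_row hi] at h2
  obtain ⟨rfl, h1, rfl⟩ := h1
  obtain ⟨h2, rfl, rfl⟩ := h2
  obtain rfl : x' = s := by omega
  refine h.eq_zero_of_occurs (by omega) (by omega) (by omega) (by omega) (by omega)
    fun b x y x' y' h3 h4 => ?_
  rw [occurs_col le_rfl] at h4
  have := occurs_zero_right h3 (by omega)
  omega

/-- A cross entry of `E` in the row of `(s + 1, i)`, apart from the one at `(i, s + 1)`. -/
theorem row_cross (h : SliceSystem s p q B K E S) {i x y : ℕ} (hi : i ≤ s) (hx : x < p) (hy : y < q)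
    (hxy : x = s + 1 ∨ y = s + 1) (h1 : ¬(x = s + 1 ∧ y = i)) (h2 : ¬(x = i ∧ y = s + 1)) :
    E (s + 1) i x y = 0 := by
  obtain rfl | rfl := hxy
  · obtain hy' | rfl | hy' := lt_trichotomy y (s + 1)
    · exact h.row_row hi (by omega) (by omega)
    · exact h.symm (h.corner_row hi)
    · exact h.symm (h.row_row_of_large_left hy' hy hi)
  · obtain hx' | rfl | hx' := lt_trichotomy x (s + 1)
    · exact h.row_col_of_ne hi (by omega) (by omega)
    · exact h.symm (h.corner_row hi)
    · exact h.symm (h.col_row_of_large_left hx' hx hi)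

/-- A cross entry of `E` in the row of `(i, s + 1)`, apart from the one at `(s + 1, i)`. -/
theorem col_cross (h : SliceSystem s p q B K E S) {i x y : ℕ} (hi : i ≤ s) (hx : x < p) (hy : y < q)
    (hxy : x = s + 1 ∨ y = s + 1) (h1 : ¬(x = s + 1 ∧ y = i)) (h2 : ¬(x = i ∧ y = s + 1)) :
    E i (s + 1) x y = 0 := by
  obtain rfl | rfl := hxy
  · obtain hy' | rfl | hy' := lt_trichotomy y (s + 1)
    · exact h.symm (h.row_col_of_ne (by omega) hi (by omega))
    · exact h.symm (h.corner_col hi)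
    · exact h.symm (h.row_col_of_large hy' hy hi)
  · obtain hx' | rfl | hx' := lt_trichotomy x (s + 1)
    · exact h.col_col hi (by omega) (by omega)
    · exact h.symm (h.corner_col hi)
    · exact h.symm (h.col_col_of_large_left hx' hx hi)

/-- If `2 * i = s`, the row of `E` at `(s + 1, i)` has at most two nonzero entries. -/
theorem row_any (h : SliceSystem s p q B K E S) {i j k : ℕ} (hi : 2 * i = s) (hj : j < p)
    (hk : k < q) (h1 : ¬(j = s + 1 ∧ k = i)) (h2 : ¬(j = i ∧ k = s + 1)) :
    E (s + 1) i j k = 0 := by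
  have := h.le_left; have := h.le_right; have := h.pos
  refine h.eq_zero_of_occurs (by omega) (by omega) (by omega) (by omega) (by omega)
    fun a x y x' y' h3 h4 => ?_
  rw [occurs_row (by omega)] at h3
  obtain ⟨h3, rfl, rfl⟩ := h3
  have h5 := h4.lt h.pos h.le_left h.le_right hj hk
  have h6 : (x' = s + 1 ∨ y' = s + 1) ∧ ¬(x' = s + 1 ∧ y' = x) ∧ ¬(x' = x ∧ y' = s + 1) := by
    unfold Occurs at h4
    split_ifs at h4 <;> omega
  exact h.col_cross (by omega) h5.1 h5.2 h6.1 h6.2.1 h6.2.2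

/-- If `2 * i = s`, the row of `E` at `(i, s + 1)` has at most two nonzero entries. -/
theorem col_any (h : SliceSystem s p q B K E S) {i j k : ℕ} (hi : 2 * i = s) (hj : j < p)
    (hk : k < q) (h1 : ¬(j = s + 1 ∧ k = i)) (h2 : ¬(j = i ∧ k = s + 1)) :
    E i (s + 1) j k = 0 := by
  have := h.le_left; have := h.le_right; have := h.pos
  refine h.eq_zero_of_occurs (by omega) (by omega) (by omega) (by omega) (by omega)
    fun a x y x' y' h3 h4 => ?_
  rw [occurs_col (by omega)] at h3
  obtain ⟨rfl, rfl, h3⟩ := h3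
  obtain rfl : a = y := by omega
  have h5 := h4.lt h.pos h.le_left h.le_right hj hk
  have h6 : (x' = s + 1 ∨ y' = s + 1) ∧ ¬(x' = s + 1 ∧ y' = a) ∧ ¬(x' = a ∧ y' = s + 1) := by
    unfold Occurs at h4
    split_ifs at h4 <;> omega
  exact h.row_cross (by omega) h5.1 h5.2 h6.1 h6.2.1 h6.2.2

/-- The entry at `(s + 1, i)` and `(i, s + 1)` with `2 * i = s` is not forced to vanish by the pairs
of labelled states alone, which only make it purely imaginary. The stopper state excludes this
possibility, because the diagonal of `E` is real. -/
theorem row_col_middle (h : SliceSystem s p q B K E S) {i : ℕ} (hi : 2 * i = s) :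
    E (s + 1) i i (s + 1) = 0 := by
  have := h.le_left; have := h.le_right; have := h.pos
  have hsi : s - i = i := by omega
  have t1 : tail s K (s + 1) i = -K i i (s + 1) := by
    simp [tail, hsi, show i < s + 1 by omega]
  have t2 : tail s K i (s + 1) = -K i (s + 1) i := by
    simp [tail, hsi, show i < s + 1 by omega]
  -- With `x` the entry in question, the labelled states give `x + conj x = 0`, and the difference of
  -- the two row sums gives `2 * x` equal to a real number.
  have e1 := h.form_tail_tail (j := s + 1) (k := i) (j' := i) (k' := s + 1) (by omega) (by omega)
    (by omega) (by omega) (by omega)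
  rw [t1, t2, map_neg, map_neg, LinearMap.neg_apply, neg_neg,
    h.form_same _ _ _ _ _ (by omega)] at e1
  have e2 := h.form_labelled_stopper (s + 1) i (by omega) (by omega)
  have r1 : ∑ z ∈ Finset.range p ×ˢ Finset.range q, E (s + 1) i z.1 z.2 =
      E (s + 1) i (s + 1) i + E (s + 1) i i (s + 1) := by
    rw [Finset.sum_eq_add_of_mem (s + 1, i) (i, s + 1)
      (Finset.mem_product.mpr ⟨Finset.mem_range.mpr (by omega), Finset.mem_range.mpr (by omega)⟩)
      (Finset.mem_product.mpr ⟨Finset.mem_range.mpr (by omega), Finset.mem_range.mpr (by omega)⟩)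
      (by rw [Ne, Prod.mk.injEq]; omega)]
    rintro ⟨x, y⟩ hz ⟨hn1, hn2⟩
    rw [Finset.mem_product, Finset.mem_range, Finset.mem_range] at hz
    rw [Ne, Prod.mk.injEq] at hn1 hn2
    exact h.row_any hi hz.1 hz.2 hn1 hn2
  have r2 : ∑ z ∈ Finset.range p ×ˢ Finset.range q, E i (s + 1) z.1 z.2 =
      E i (s + 1) (s + 1) i + E i (s + 1) i (s + 1) := by
    rw [Finset.sum_eq_add_of_mem (s + 1, i) (i, s + 1)
      (Finset.mem_product.mpr ⟨Finset.mem_range.mpr (by omega), Finset.mem_range.mpr (by omega)⟩)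
      (Finset.mem_product.mpr ⟨Finset.mem_range.mpr (by omega), Finset.mem_range.mpr (by omega)⟩)
      (by rw [Ne, Prod.mk.injEq]; omega)]
    rintro ⟨x, y⟩ hz ⟨hn1, hn2⟩
    rw [Finset.mem_product, Finset.mem_range, Finset.mem_range] at hz
    rw [Ne, Prod.mk.injEq] at hn1 hn2
    exact h.col_any hi hz.1 hz.2 hn1 hn2
  rw [labelled, t1, map_add, map_neg, LinearMap.add_apply, LinearMap.neg_apply,
    h.row _ _ _ (by omega) (by omega) (by omega), h.row _ _ _ (by omega) (by omega) (by omega),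
    r1, r2] at e2
  have d1 := Complex.conj_eq_iff_im.mp (h.herm (s + 1) i (s + 1) i).symm
  have d2 := Complex.conj_eq_iff_im.mp (h.herm i (s + 1) i (s + 1)).symm
  have c := h.herm (s + 1) i i (s + 1)
  rw [c] at e1 e2
  have e3 := congrArg Complex.re e1
  have e4 := congrArg Complex.im e2
  simp only [Complex.add_re, Complex.add_im, Complex.neg_im, Complex.conj_re, Complex.conj_im,
    Complex.zero_re, Complex.zero_im, d1, d2] at e3 e4
  apply Complex.ext
  · rw [Complex.zero_re]; linarith
  · rw [Complex.zero_im]; linarith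

theorem row_col (h : SliceSystem s p q B K E S) {i k : ℕ} (hi : i ≤ s) (hk : k ≤ s) :
    E (s + 1) i k (s + 1) = 0 := by
  by_cases hne : i = k ∧ 2 * i = s
  · obtain ⟨rfl, h2⟩ := hne
    exact h.row_col_middle h2
  · exact h.row_col_of_ne hi hk hne

/-- For `s = 2` the tracing of the entry at `(s + 2, s + 1)` and `(s + 1, s + 2)` ends in the middle
entry `row_col_middle`, so that the stopper state is needed here, too. -/
theorem col_row_of_large (h : SliceSystem s p q B K E S) {j : ℕ} (hj : s + 1 < j) (hjp : j < p)
    {k : ℕ} (hk : s + 1 < k) (hkq : k < q) : E j (s + 1) (s + 1) k = 0 := by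
  induction j using Nat.strong_induction_on generalizing k with
  | _ j ih =>
  have := h.le_left; have := h.le_right; have := h.pos
  refine h.eq_zero_of_occurs (by omega) (by omega) (by omega) (by omega) (by omega)
    fun a x y x' y' h1 h2 => ?_
  rw [occurs_col_large hj] at h1
  rw [occurs_row_large hk] at h2
  obtain ⟨rfl, h1, rfl⟩ := h1
  obtain ⟨-, rfl, h2⟩ := h2
  refine h.eq_zero_of_occurs (by omega) (by omega) (by omega) (by omega) (by omega)
    fun b x₁ y₁ x₂ y₂ h3 h4 => ?_
  obtain ⟨h5, rfl, rfl, rfl⟩ | ⟨h5, rfl, rfl, rfl⟩ | ⟨h5, ⟨rfl, rfl, rfl⟩ | ⟨rfl, rfl, rfl⟩⟩ :=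
    occurs_zero_right h3 (by omega) <;>
  obtain ⟨h6, h7, rfl, rfl⟩ | ⟨h6, h7, rfl, rfl⟩ | ⟨h6, ⟨h7, rfl, rfl⟩ | ⟨h7, rfl, rfl⟩⟩ :=
    occurs_zero_left h4 (by omega)
  · exact ih _ (by omega) h5 (by omega) h6 (by omega)
  · omega
  · exact h.col_col_of_large_left h5 (by omega) (by omega)
  · omega
  · exact h.symm (h.row_corner_of_large h6 (by omega))
  · omega
  · omega
  · omega
  · omega
  · omega
  · omega
  · exact h.symm (h.row_col (by omega) (by omega))
  · exact h.symm (h.row_row_of_large_left h6 (by omega) (by omega))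
  · omega
  · exact h.row_col (by omega) (by omega)
  · omega

theorem col_col_of_large (h : SliceSystem s p q B K E S) {j : ℕ} (hj : s + 1 < j) (hjp : j < p)
    {l : ℕ} (hl : s + 1 < l) (hlp : l < p) (hne : j ≠ l) : E j (s + 1) l (s + 1) = 0 := by
  induction j using Nat.strong_induction_on generalizing l with
  | _ j ih =>
  have := h.le_left; have := h.le_right; have := h.pos
  refine h.eq_zero_of_occurs (by omega) (by omega) (by omega) (by omega) (by omega)
    fun a x y x' y' h1 h2 => ?_
  rw [occurs_col_large hj] at h1
  rw [occurs_col_large hl] at h2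
  obtain ⟨rfl, h1, rfl⟩ := h1
  obtain ⟨-, h2, rfl⟩ := h2
  refine h.eq_zero_of_occurs (by omega) (by omega) (by omega) (by omega) (by omega)
    fun b x₁ y₁ x₂ y₂ h3 h4 => ?_
  obtain ⟨h5, rfl, rfl, rfl⟩ | ⟨h5, rfl, rfl, rfl⟩ | ⟨h5, ⟨rfl, rfl, rfl⟩ | ⟨rfl, rfl, rfl⟩⟩ :=
    occurs_zero_right h3 (by omega) <;>
  obtain ⟨h6, h7, rfl, rfl⟩ | ⟨h6, h7, rfl, rfl⟩ | ⟨h6, ⟨h7, rfl, rfl⟩ | ⟨h7, rfl, rfl⟩⟩ :=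
    occurs_zero_right h4 (by omega)
  · exact ih _ (by omega) h5 (by omega) h6 (by omega) (by omega)
  · exact h.col_corner_of_large h5 (by omega)
  · omega
  · exact h.col_row_of_large_left h5 (by omega) (by omega)
  · exact h.symm (h.col_corner_of_large h6 (by omega))
  · omega
  · omega
  · omega
  · omega
  · omega
  · omega
  · omega
  · exact h.symm (h.col_row_of_large_left h6 (by omega) (by omega))
  · omega
  · omega
  · omega

/-- All off-diagonal entries of `E` within the cross `{x = s + 1} ∪ {y = s + 1}` vanish. -/
theorem cross_cross (h : SliceSystem s p q B K E S) {x y x' y' : ℕ} (hx : x < p) (hy : y < q)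
    (hx' : x' < p) (hy' : y' < q) (hxy : x = s + 1 ∨ y = s + 1) (hxy' : x' = s + 1 ∨ y' = s + 1)
    (hne : ¬(x = x' ∧ y = y')) : E x y x' y' = 0 := by
  have key : ∀ {x y x' y' : ℕ}, x < p → y < q → x' < p → y' < q →
      (x = s + 1 ∧ y ≤ s ∨ x ≤ s ∧ y = s + 1) → (x' = s + 1 ∨ y' = s + 1) →
      ¬(x = x' ∧ y = y') → E x y x' y' = 0 := by
    rintro x y x' y' hx hy hx' hy' (⟨rfl, hs⟩ | ⟨hs, rfl⟩) hxy' hne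
    · by_cases hm : x' = y ∧ y' = s + 1
      · obtain ⟨rfl, rfl⟩ := hm
        exact h.row_col hs hs
      · exact h.row_cross hs hx' hy' hxy' (by omega) hm
    · by_cases hm : x' = s + 1 ∧ y' = x
      · obtain ⟨rfl, rfl⟩ := hm
        exact h.symm (h.row_col hs hs)
      · exact h.col_cross hs hx' hy' hxy' hm (by omega)
  by_cases h1 : x = s + 1 ∧ y ≤ s ∨ x ≤ s ∧ y = s + 1
  · exact key hx hy hx' hy' h1 hxy' hne
  by_cases h2 : x' = s + 1 ∧ y' ≤ s ∨ x' ≤ s ∧ y' = s + 1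
  · exact h.symm (key hx' hy' hx hy h2 hxy (by omega))
  obtain ⟨rfl, rfl⟩ | ⟨rfl, h3⟩ | ⟨h3, rfl⟩ : (x = s + 1 ∧ y = s + 1) ∨ (x = s + 1 ∧ s + 1 < y) ∨
    (s + 1 < x ∧ y = s + 1) := by omega
  all_goals
    obtain ⟨rfl, rfl⟩ | ⟨rfl, h4⟩ | ⟨h4, rfl⟩ : (x' = s + 1 ∧ y' = s + 1) ∨
      (x' = s + 1 ∧ s + 1 < y') ∨ (s + 1 < x' ∧ y' = s + 1) := by omega
  · omega
  · exact h.symm (h.row_corner_of_large h4 hy')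
  · exact h.symm (h.col_corner_of_large h4 hx')
  · exact h.row_corner_of_large h3 hy
  · exact h.row_row_of_large h3 hy h4 hy' (by omega)
  · exact h.symm (h.col_row_of_large h4 hx' h3 hy)
  · exact h.col_corner_of_large h3 hx
  · exact h.col_row_of_large h3 hx h4 hy'
  · exact h.col_col_of_large h3 hx h4 hx' (by omega)

/-- All off-diagonal entries of `E` between labels with a coordinate below `s + 1` vanish. -/
theorem low_low (h : SliceSystem s p q B K E S) {j k j' k' : ℕ} (hj : j < p) (hk : k < q)
    (hj' : j' < p) (hk' : k' < q) (hl : j ≤ s ∨ k ≤ s) (hl' : j' ≤ s ∨ k' ≤ s)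
    (hne : ¬(j = j' ∧ k = k')) : E j k j' k' = 0 := by
  refine h.eq_zero_of_occurs hj hk hj' hk' hne fun a x y x' y' h1 h2 => ?_
  have b1 := h1.lt h.pos h.le_left h.le_right hj hk
  have b2 := h2.lt h.pos h.le_left h.le_right hj' hk'
  refine h.cross_cross b1.1 b1.2 b2.1 b2.2 (h1.cross hl) (h2.cross hl') ?_
  rintro ⟨rfl, rfl⟩
  exact hne (h1.unique h.pos h2)

/-- The entry at the corner and `(0, s)` is traced to the one at `(s, s)` and the corner, and only a
second step leads to labels with a coordinate below `s + 1`. -/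
theorem corner_low (h : SliceSystem s p q B K E S) {j k : ℕ} (hj : j < p) (hk : k < q)
    (hl : j ≤ s ∨ k ≤ s) : E (s + 1) (s + 1) j k = 0 := by
  have := h.le_left; have := h.le_right; have hpos := h.pos
  refine h.eq_zero_of_occurs (by omega) (by omega) hj hk (by omega) fun a x y x' y' h1 h2 => ?_
  rw [occurs_corner] at h1
  obtain ⟨_, _, _⟩ := h1
  subst a x y
  have hc := h2.cross hl
  have hb := h2.lt hpos h.le_left h.le_right hj hk
  by_cases hlow : x' ≤ s ∨ y' ≤ s
  · exact h.low_low (by omega) (by omega) hb.1 hb.2 (by omega) hlow (by omega)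
  obtain ⟨rfl, rfl⟩ | ⟨rfl, h3⟩ | ⟨h3, rfl⟩ : (x' = s + 1 ∧ y' = s + 1) ∨
    (x' = s + 1 ∧ s + 1 < y') ∨ (s + 1 < x' ∧ y' = s + 1) := by omega
  · apply h.symm
    refine h.eq_zero_of_occurs (by omega) (by omega) (by omega) (by omega) (by omega)
      fun b x y x' y' h3 h4 => ?_
    rw [occurs_corner] at h3
    obtain ⟨_, _, _⟩ := h3
    subst b x y
    have hb := h4.lt hpos h.le_left h.le_right (by omega) (by omega)
    have : (x' = s ∧ y' = s + 1) ∨ (x' = s + 1 ∧ y' = s) := by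
      unfold Occurs at h4
      split_ifs at h4 <;> omega
    exact h.low_low (by omega) (by omega) hb.1 hb.2 (by omega) (by omega) (by omega)
  · apply h.symm
    refine h.eq_zero_of_occurs (by omega) (by omega) (by omega) (by omega) (by omega)
      fun b x y x' y' h4 h5 => ?_
    rw [occurs_row_large h3] at h4
    unfold Occurs at h5
    split_ifs at h5 <;> omega
  · apply h.symm
    refine h.eq_zero_of_occurs (by omega) (by omega) (by omega) (by omega) (by omega)
      fun b x y x' y' h4 h5 => ?_
    rw [occurs_col_large h3] at h4
    unfold Occurs at h5
    split_ifs at h5 <;> omega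

/-- Two steps decrease the large coordinate by one, or lead to labels that are treated already; hence
the induction. -/
theorem row_low (h : SliceSystem s p q B K E S) {k : ℕ} (hk : s + 1 < k) (hkq : k < q)
    {j' k' : ℕ} (hj' : j' < p) (hk' : k' < q) (hl : j' ≤ s ∨ k' ≤ s) :
    E (s + 1) k j' k' = 0 := by
  induction k using Nat.strong_induction_on generalizing j' k' with
  | _ k ih =>
  have := h.le_left; have := h.le_right; have hpos := h.pos
  refine h.eq_zero_of_occurs (by omega) (by omega) hj' hk' (by omega) fun a x y x' y' h1 h2 => ?_
  rw [occurs_row_large hk] at h1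
  obtain ⟨rfl, rfl, h1⟩ := h1
  have hc := h2.cross hl
  have hb := h2.lt hpos h.le_left h.le_right hj' hk'
  by_cases hlow : x' ≤ s ∨ y' ≤ s
  · exact h.low_low (by omega) (by omega) hb.1 hb.2 (by omega) hlow (by omega)
  apply h.symm
  obtain ⟨rfl, rfl⟩ | ⟨rfl, h3⟩ | ⟨h3, rfl⟩ : (x' = s + 1 ∧ y' = s + 1) ∨
    (x' = s + 1 ∧ s + 1 < y') ∨ (s + 1 < x' ∧ y' = s + 1) := by omega
  · exact h.corner_low (by omega) (by omega) (by omega)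
  · refine h.eq_zero_of_occurs (by omega) (by omega) (by omega) (by omega) (by omega)
      fun b x₁ y₁ x₂ y₂ h4 h5 => ?_
    rw [occurs_row_large h3] at h4
    obtain ⟨rfl, rfl, h4⟩ := h4
    have hb := h5.lt hpos h.le_left h.le_right (by omega) (by omega)
    obtain ⟨h6, -, rfl, rfl⟩ | h6 | h6 := occurs_zero_left h5 (by omega)
    · exact h.symm (ih _ (by omega) h6 hb.2 (by omega) (by omega) (by omega))
    · omega
    · exact h.low_low (by omega) (by omega) hb.1 hb.2 (by omega) (by omega) (by omega)
  · refine h.eq_zero_of_occurs (by omega) (by omega) (by omega) (by omega) (by omega)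
      fun b x₁ y₁ x₂ y₂ h4 h5 => ?_
    rw [occurs_col_large h3] at h4
    obtain ⟨rfl, h4, rfl⟩ := h4
    have hb := h5.lt hpos h.le_left h.le_right (by omega) (by omega)
    obtain ⟨h6, -, rfl, rfl⟩ | h6 | h6 := occurs_zero_left h5 (by omega)
    · exact h.symm (ih _ (by omega) h6 hb.2 (by omega) (by omega) (by omega))
    · omega
    · exact h.low_low (by omega) (by omega) hb.1 hb.2 (by omega) (by omega) (by omega)

theorem col_low (h : SliceSystem s p q B K E S) {j : ℕ} (hj : s + 1 < j) (hjp : j < p)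
    {j' k' : ℕ} (hj' : j' < p) (hk' : k' < q) (hl : j' ≤ s ∨ k' ≤ s) :
    E j (s + 1) j' k' = 0 := by
  induction j using Nat.strong_induction_on generalizing j' k' with
  | _ j ih =>
  have := h.le_left; have := h.le_right; have hpos := h.pos
  refine h.eq_zero_of_occurs (by omega) (by omega) hj' hk' (by omega) fun a x y x' y' h1 h2 => ?_
  rw [occurs_col_large hj] at h1
  obtain ⟨rfl, h1, rfl⟩ := h1
  have hc := h2.cross hl
  have hb := h2.lt hpos h.le_left h.le_right hj' hk'
  by_cases hlow : x' ≤ s ∨ y' ≤ s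
  · exact h.low_low (by omega) (by omega) hb.1 hb.2 (by omega) hlow (by omega)
  apply h.symm
  obtain ⟨rfl, rfl⟩ | ⟨rfl, h3⟩ | ⟨h3, rfl⟩ : (x' = s + 1 ∧ y' = s + 1) ∨
    (x' = s + 1 ∧ s + 1 < y') ∨ (s + 1 < x' ∧ y' = s + 1) := by omega
  · exact h.corner_low (by omega) (by omega) (by omega)
  · exact h.row_low h3 hb.2 (by omega) (by omega) (by omega)
  · refine h.eq_zero_of_occurs (by omega) (by omega) (by omega) (by omega) (by omega)
      fun b x₁ y₁ x₂ y₂ h4 h5 => ?_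
    rw [occurs_col_large h3] at h4
    obtain ⟨rfl, h4, rfl⟩ := h4
    have hb := h5.lt hpos h.le_left h.le_right (by omega) (by omega)
    obtain ⟨h6, -, rfl, rfl⟩ | ⟨h6, -, rfl, rfl⟩ | h6 := occurs_zero_right h5 (by omega)
    · exact h.symm (ih _ (by omega) h6 hb.1 (by omega) (by omega) (by omega))
    · exact h.symm (h.corner_low (by omega) (by omega) (by omega))
    · exact h.low_low (by omega) (by omega) hb.1 hb.2 (by omega) (by omega) (by omega)

theorem large_low (h : SliceSystem s p q B K E S) {j k : ℕ} (hj : s + 1 < j) (hjp : j < p)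
    (hk : s + 1 < k) (hkq : k < q) {j' k' : ℕ} (hj' : j' < p) (hk' : k' < q)
    (hl : j' ≤ s ∨ k' ≤ s) : E j k j' k' = 0 := by
  induction j using Nat.strong_induction_on generalizing j' k' with
  | _ j ih =>
  have := h.le_left; have := h.le_right; have hpos := h.pos
  -- The entry of `E` at the label reached by one application of `shift` on the left.
  have descend : ∀ {x x' y' : ℕ}, (j = s + 2 ∧ x = 1 ∨ s + 2 < j ∧ x + 1 = j) → x' < p → y' < q →
      (x' ≤ s ∨ y' ≤ s) → ¬(x = x' ∧ k = y') → E x k x' y' = 0 := by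
    intro x x' y' hx hx' hy' hl hne
    by_cases hxs : s + 1 < x
    · exact ih x (by omega) hxs (by omega) hx' hy' hl
    · exact h.low_low (by omega) hkq hx' hy' (by omega) hl hne
  refine h.eq_zero_of_occurs hjp hkq hj' hk' (by omega) fun a x y x' y' h1 h2 => ?_
  rw [occurs_large_large hj hk] at h1
  obtain ⟨rfl, h1, rfl⟩ := h1
  have hc := h2.cross hl
  have hb := h2.lt hpos h.le_left h.le_right hj' hk'
  by_cases hlow : x' ≤ s ∨ y' ≤ s
  · exact descend h1 hb.1 hb.2 hlow (by omega)
  obtain ⟨rfl, rfl⟩ | ⟨rfl, h3⟩ | ⟨h3, rfl⟩ : (x' = s + 1 ∧ y' = s + 1) ∨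
    (x' = s + 1 ∧ s + 1 < y') ∨ (s + 1 < x' ∧ y' = s + 1) := by omega
  all_goals by_cases hx : s + 1 < x
  · refine h.eq_zero_of_occurs (by omega) (by omega) (by omega) (by omega) (by omega)
      fun b x₁ y₁ x₂ y₂ h4 h5 => ?_
    rw [occurs_large_large hx hk] at h4
    rw [occurs_corner] at h5
    omega
  · exact h.symm (h.corner_low (by omega) (by omega) (by omega))
  · refine h.eq_zero_of_occurs (by omega) (by omega) (by omega) (by omega) (by omega)
      fun b x₁ y₁ x₂ y₂ h4 h5 => ?_
    rw [occurs_large_large hx hk] at h4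
    rw [occurs_row_large h3] at h5
    obtain ⟨rfl, h4, rfl⟩ := h4
    obtain ⟨-, rfl, h5⟩ := h5
    by_cases hxs : s + 1 < x₁
    · exact ih x₁ (by omega) hxs (by omega) (by omega) (by omega) (by omega)
    · exact h.low_low (by omega) (by omega) (by omega) (by omega) (by omega) (by omega) (by omega)
  · exact h.symm (h.row_low h3 hb.2 (by omega) (by omega) (by omega))
  · refine h.eq_zero_of_occurs (by omega) (by omega) (by omega) (by omega) (by omega)
      fun b x₁ y₁ x₂ y₂ h4 h5 => ?_
    rw [occurs_large_large hx hk] at h4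
    rw [occurs_col_large h3] at h5
    obtain ⟨rfl, h4, rfl⟩ := h4
    obtain ⟨-, h5, rfl⟩ := h5
    by_cases hxs : s + 1 < x₁
    · exact ih x₁ (by omega) hxs (by omega) (by omega) (by omega) (by omega)
    · exact h.low_low (by omega) (by omega) (by omega) (by omega) (by omega) (by omega) (by omega)
  · exact h.symm (h.col_low h3 hb.1 (by omega) (by omega) (by omega))

theorem large_cross (h : SliceSystem s p q B K E S) {j k : ℕ} (hj : s + 1 < j) (hjp : j < p)
    (hk : s + 1 < k) (hkq : k < q) {x y : ℕ} (hx : x < p) (hy : y < q)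
    (hxy : x = s + 1 ∨ y = s + 1) : E j k x y = 0 := by
  have := h.le_left; have := h.le_right; have hpos := h.pos
  by_cases hlow : x ≤ s ∨ y ≤ s
  · exact h.large_low hj hjp hk hkq hx hy hlow
  refine h.eq_zero_of_occurs hjp hkq hx hy (by omega) fun a x₁ y₁ x₂ y₂ h1 h2 => ?_
  rw [occurs_large_large hj hk] at h1
  obtain ⟨rfl, h1, rfl⟩ := h1
  have hb := h2.lt hpos h.le_left h.le_right hx hy
  have h3 : x₂ ≤ s ∨ y₂ ≤ s := by
    unfold Occurs at h2
    split_ifs at h2 <;> omega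
  have h4 : ¬(x₁ = x₂ ∧ y₁ = y₂) := by
    unfold Occurs at h2
    split_ifs at h2 <;> omega
  by_cases hxs : s + 1 < x₁
  · exact h.large_low hxs (by omega) hk hkq hb.1 hb.2 h3
  · exact h.low_low (by omega) hkq hb.1 hb.2 (by omega) h3 h4

theorem large_large (h : SliceSystem s p q B K E S) {j k : ℕ} (hj : s + 1 < j) (hjp : j < p)
    (hk : s + 1 < k) (hkq : k < q) {j' k' : ℕ} (hj' : s + 1 < j') (hjp' : j' < p)
    (hk' : s + 1 < k') (hkq' : k' < q) (hne : ¬(j = j' ∧ k = k')) : E j k j' k' = 0 := by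
  induction j using Nat.strong_induction_on generalizing j' with
  | _ j ih =>
  have hpos := h.pos
  refine h.eq_zero_of_occurs hjp hkq hjp' hkq' hne fun a x y x' y' h1 h2 => ?_
  rw [occurs_large_large hj hk] at h1
  rw [occurs_large_large hj' hk'] at h2
  obtain ⟨rfl, h1, rfl⟩ := h1
  obtain ⟨-, h2, rfl⟩ := h2
  by_cases hx : s + 1 < x
  · by_cases hx' : s + 1 < x'
    · exact ih x (by omega) hx (by omega) hx' (by omega) (by omega)
    · exact h.large_low hx (by omega) hk hkq (by omega) hkq' (by omega)
  · by_cases hx' : s + 1 < x'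
    · exact h.symm (h.large_low hx' (by omega) hk' hkq' (by omega) hkq (by omega))
    · exact h.low_low (by omega) hkq (by omega) hkq' (by omega) (by omega) (by omega)

/-- `E` is diagonal. -/
theorem off_diagonal (h : SliceSystem s p q B K E S) {j k j' k' : ℕ} (hj : j < p) (hk : k < q)
    (hj' : j' < p) (hk' : k' < q) (hne : ¬(j = j' ∧ k = k')) : E j k j' k' = 0 := by
  have key : ∀ {j k j' k' : ℕ}, j < p → k < q → j' < p → k' < q → (j ≤ s ∨ k ≤ s) →
      ¬(j = j' ∧ k = k') → E j k j' k' = 0 := by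
    intro j k j' k' hj hk hj' hk' hl hne
    by_cases hl' : j' ≤ s ∨ k' ≤ s
    · exact h.low_low hj hk hj' hk' hl hl' hne
    apply h.symm
    obtain ⟨rfl, rfl⟩ | ⟨rfl, h3⟩ | ⟨h3, rfl⟩ | ⟨h3, h4⟩ : (j' = s + 1 ∧ k' = s + 1) ∨
      (j' = s + 1 ∧ s + 1 < k') ∨ (s + 1 < j' ∧ k' = s + 1) ∨ (s + 1 < j' ∧ s + 1 < k') := by omega
    · exact h.corner_low hj hk hl
    · exact h.row_low h3 hk' hj hk hl
    · exact h.col_low h3 hj' hj hk hl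
    · exact h.large_low h3 hj' h4 hk' hj hk hl
  by_cases h1 : j ≤ s ∨ k ≤ s
  · exact key hj hk hj' hk' h1 hne
  by_cases h2 : j' ≤ s ∨ k' ≤ s
  · exact h.symm (key hj' hk' hj hk h2 (by omega))
  by_cases h3 : j = s + 1 ∨ k = s + 1
  · by_cases h4 : j' = s + 1 ∨ k' = s + 1
    · exact h.cross_cross hj hk hj' hk' h3 h4 hne
    · exact h.symm (h.large_cross (by omega) hj' (by omega) hk' hj hk h3)
  · by_cases h4 : j' = s + 1 ∨ k' = s + 1
    · exact h.large_cross (by omega) hj (by omega) hk hj' hk' h4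
    · exact h.large_large (by omega) hj (by omega) hk (by omega) hj' (by omega) hk' hne

end SliceSystem

end Vanishing

/-! ### The diagonal is constant -/

theorem ω₃_eq : ω₃ = ⟨-1 / 2, √3 / 2⟩ := by
  have h : (2 * Real.pi * Complex.I / 3 : ℂ) = ((Real.pi - Real.pi / 3 : ℝ) : ℂ) * Complex.I := by
    push_cast
    ring
  rw [ω₃, h, Complex.exp_mul_I, ← Complex.ofReal_cos, ← Complex.ofReal_sin, Real.cos_pi_sub,
    Real.sin_pi_sub, Real.cos_pi_div_three, Real.sin_pi_div_three]
  apply Complex.ext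
  · simp
    norm_num
  · simp

theorem ω₃_pow_three : ω₃ ^ 3 = 1 := by
  rw [ω₃, ← Complex.exp_nat_mul, Complex.exp_eq_one_iff]
  exact ⟨1, by push_cast; ring⟩

theorem one_add_ω₃_add : 1 + (ω₃ + ω₃ ^ 2) = 0 := by
  have h3 : ((√3 : ℝ) : ℂ) * ((√3 : ℝ) : ℂ) = 3 := by
    rw [← Complex.ofReal_mul, Real.mul_self_sqrt (by norm_num)]
    norm_num
  have h : ω₃ = -1 / 2 + (√3 : ℝ) / 2 * Complex.I := by
    rw [ω₃_eq]
    apply Complex.ext <;> simp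
  rw [h]
  linear_combination (-1 / 4 : ℂ) * h3 + ((√3 : ℝ) : ℂ) ^ 2 / 4 * Complex.I_sq

/-- A real linear relation between the cube roots of unity has equal coefficients. -/
theorem eq_of_add_ω₃_eq_zero {a b c : ℂ} (ha : a.im = 0) (hb : b.im = 0) (hc : c.im = 0)
    (h : a + (starRingEnd ℂ ω₃ * b + starRingEnd ℂ ω₃ ^ 2 * c) = 0) : b = a ∧ c = a := by
  have h3 : √3 * √3 = 3 := Real.mul_self_sqrt (by norm_num)
  have hpos : 0 < √3 := by positivity
  have h1 := congrArg Complex.re h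
  have h2 := congrArg Complex.im h
  rw [ω₃_eq] at h1 h2
  simp only [pow_two, Complex.add_re, Complex.add_im, Complex.mul_re, Complex.mul_im,
    Complex.conj_re, Complex.conj_im, Complex.zero_re, Complex.zero_im, ha, hb, hc] at h1 h2
  have hbc : √3 * (c.re - b.re) = 0 := by linear_combination 2 * h2
  have hbc' : c.re = b.re := by
    rcases mul_eq_zero.mp hbc with h0 | h0
    · exact absurd h0 hpos.ne'
    · linarith
  have hab : a.re = b.re := by
    rw [hbc'] at h1
    linear_combination h1 + b.re / 4 * h3
  exact ⟨Complex.ext hab.symm (by rw [ha, hb]), Complex.ext (by rw [hab, hbc']) (by rw [ha, hc])⟩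

section Diagonal

variable {V : Type*} [AddCommGroup V] [Module ℂ V] {s p q : ℕ} {B : V →ₗ⋆[ℂ] V →ₗ[ℂ] ℂ}
  {K : ℕ → ℕ → ℕ → V} {E : ℕ → ℕ → ℕ → ℕ → ℂ} {S : V}

/-- A tail is minus one basis state or the tail of a W-like state, and nothing else occurs in it. -/
theorem tail_eq_neg_or_eq_add (s : ℕ) (K : ℕ → ℕ → ℕ → V) (j k : ℕ) :
    (∃ a x y, tail s K j k = -K a x y ∧ Occurs s a x y j k ∧
      ∀ a' x' y', Occurs s a' x' y' j k → x' = x ∧ y' = y) ∨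
    (∃ a x y b u v, tail s K j k = ω₃ • K a x y + ω₃ ^ 2 • K b u v ∧ Occurs s a x y j k ∧
      Occurs s b u v j k ∧
      ∀ a' x' y', Occurs s a' x' y' j k → (x' = x ∧ y' = y) ∨ (x' = u ∧ y' = v)) := by
  unfold tail Occurs
  have := @shift_spec s j
  have := @shift_spec s k
  split_ifs
  case neg => exact Or.inr ⟨_, _, _, _, _, _, rfl, by omega, by omega, by omega⟩
  all_goals exact Or.inl ⟨_, _, _, rfl, by omega, by omega⟩

namespace SliceSystem

theorem form_stopper (h : SliceSystem s p q B K E S) {a j k : ℕ} (ha : a ≤ s) (hj : j < p)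
    (hk : k < q) : B (K a j k) S = E j k j k := by
  rw [h.row a j k (by omega) hj hk, Finset.sum_eq_single (j, k)]
  · rintro ⟨x, y⟩ hz hne
    rw [Finset.mem_product, Finset.mem_range, Finset.mem_range] at hz
    rw [Ne, Prod.mk.injEq] at hne
    exact h.off_diagonal hj hk hz.1 hz.2 (by omega)
  · simp [hj, hk]

/-- The diagonal of `E` is constant along the basis states of a labelled state. -/
theorem diagonal_eq_of_occurs (h : SliceSystem s p q B K E S) {a x y j k : ℕ}
    (hocc : Occurs s a x y j k) (hj : j < p) (hk : k < q) : E x y x y = E j k j k := by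
  have hs := h.form_labelled_stopper j k hj hk
  have h1 : B (K (s + 1) j k) S = E j k j k := by
    rw [h.row _ _ _ (by omega) hj hk, ← h.row 0 _ _ (by omega) hj hk,
      h.form_stopper (Nat.zero_le _) hj hk]
  have him : ∀ j k, (E j k j k).im = 0 := fun j k =>
    Complex.conj_eq_iff_im.mp (h.herm j k j k).symm
  have hB : ∀ {a x y}, Occurs s a x y j k → B (K a x y) S = E x y x y := fun ho =>
    have hb := ho.lt h.pos h.le_left h.le_right hj hk
    h.form_stopper ho.slice_le hb.1 hb.2
  rw [labelled, map_add, LinearMap.add_apply, h1] at hs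
  obtain ⟨b, u, v, ht, ho, hu⟩ | ⟨b, u, v, b', u', v', ht, ho, ho', hu⟩ :=
    tail_eq_neg_or_eq_add s K j k
  · rw [ht, map_neg, LinearMap.neg_apply, hB ho] at hs
    obtain ⟨rfl, rfl⟩ := hu _ _ _ hocc
    linear_combination -hs
  · rw [ht, map_add, LinearMap.map_smulₛₗ, LinearMap.map_smulₛₗ, LinearMap.add_apply,
      LinearMap.smul_apply, LinearMap.smul_apply, hB ho, hB ho', smul_eq_mul, smul_eq_mul,
      map_pow] at hs
    have := eq_of_add_ω₃_eq_zero (him _ _) (him _ _) (him _ _) hs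
    obtain ⟨rfl, rfl⟩ | ⟨rfl, rfl⟩ := hu _ _ _ hocc
    · exact this.1
    · exact this.2

/-- The diagonal of `E` at the labels of the cross with a coordinate below `s + 1`. All of them are
linked to the corner through the labels `(k, s)` with `k ≠ 0`, whose two tail terms are
`(s + 1, k)` and `(s, s + 1)`. -/
theorem diagonal_row_col (h : SliceSystem s p q B K E S) {k : ℕ} (hk : k ≤ s) :
    E (s + 1) k (s + 1) k = E (s + 1) (s + 1) (s + 1) (s + 1) ∧
    E k (s + 1) k (s + 1) = E (s + 1) (s + 1) (s + 1) (s + 1) := by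
  have := h.le_left; have := h.le_right; have hpos := h.pos
  have e1 : E s s s s = E (s + 1) (s + 1) (s + 1) (s + 1) :=
    h.diagonal_eq_of_occurs (a := s) (by unfold Occurs; split_ifs <;> omega) (by omega) (by omega)
  have e2 : E s (s + 1) s (s + 1) = E s s s s :=
    h.diagonal_eq_of_occurs (a := s) (by unfold Occurs; split_ifs <;> omega) (by omega) (by omega)
  have e3 : E (s + 1) s (s + 1) s = E s s s s :=
    h.diagonal_eq_of_occurs (a := s) (by unfold Occurs; split_ifs <;> omega) (by omega) (by omega)
  have e4 : E k (s + 1) k (s + 1) = E (s + 1) k (s + 1) k :=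
    h.diagonal_eq_of_occurs (a := s - k) (by unfold Occurs; split_ifs <;> omega) (by omega)
      (by omega)
  suffices h5 : E k (s + 1) k (s + 1) = E s s s s by
    rw [← e4, h5, e1]
    exact ⟨rfl, rfl⟩
  rcases Nat.eq_zero_or_pos k with rfl | hk0
  · rw [← e3]
    exact (h.diagonal_eq_of_occurs (a := 0) (by unfold Occurs; split_ifs <;> omega) (by omega)
      (by omega)).symm
  · have e5 : E (s + 1) k (s + 1) k = E k s k s :=
      h.diagonal_eq_of_occurs (a := s) (by unfold Occurs; split_ifs <;> omega) (by omega)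
        (by omega)
    have e6 : E s (s + 1) s (s + 1) = E k s k s :=
      h.diagonal_eq_of_occurs (a := k) (by unfold Occurs; split_ifs <;> omega) (by omega)
        (by omega)
    rw [e4, e5, ← e6, e2]

theorem diagonal_small (h : SliceSystem s p q B K E S) {j k : ℕ} (hj : j ≤ s) (hk : k ≤ s) :
    E j k j k = E (s + 1) (s + 1) (s + 1) (s + 1) := by
  have := h.le_left; have := h.le_right
  by_cases hjk : j + k = s
  · exact (h.diagonal_eq_of_occurs (a := k) (by unfold Occurs; split_ifs <;> omega) (by omega)
      (by omega)).symm
  · rw [← (h.diagonal_row_col hk).2]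
    exact (h.diagonal_eq_of_occurs (a := j) (by unfold Occurs; split_ifs <;> omega) (by omega)
      (by omega)).symm

theorem diagonal_row_large (h : SliceSystem s p q B K E S) {k : ℕ} (hk : s + 1 < k) (hkq : k < q) :
    E (s + 1) k (s + 1) k = E (s + 1) (s + 1) (s + 1) (s + 1) := by
  induction k using Nat.strong_induction_on with
  | _ k ih =>
  have := h.le_left; have := h.pos
  obtain rfl | hk2 : k = s + 2 ∨ s + 2 < k := by omega
  · rw [← h.diagonal_small (Nat.zero_le s) h.pos]
    exact (h.diagonal_eq_of_occurs (a := 0) (by unfold Occurs; split_ifs <;> omega) (by omega)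
      (by omega)).symm
  · rw [← ih (k - 1) (by omega) (by omega) (by omega)]
    have e1 : E 0 (k - 1) 0 (k - 1) = E (s + 1) k (s + 1) k :=
      h.diagonal_eq_of_occurs (a := 0) (by unfold Occurs; split_ifs <;> omega) (by omega) (by omega)
    rw [← e1]
    exact (h.diagonal_eq_of_occurs (a := 0) (by unfold Occurs; split_ifs <;> omega) (by omega)
      (by omega)).symm

theorem diagonal_col_large (h : SliceSystem s p q B K E S) {j : ℕ} (hj : s + 1 < j) (hjp : j < p) :
    E j (s + 1) j (s + 1) = E (s + 1) (s + 1) (s + 1) (s + 1) := by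
  induction j using Nat.strong_induction_on with
  | _ j ih =>
  have := h.le_right; have := h.pos
  obtain rfl | hj2 : j = s + 2 ∨ s + 2 < j := by omega
  · rw [← h.diagonal_small h.pos (Nat.zero_le s)]
    exact (h.diagonal_eq_of_occurs (a := 0) (by unfold Occurs; split_ifs <;> omega) (by omega)
      (by omega)).symm
  · rw [← ih (j - 1) (by omega) (by omega) (by omega)]
    have e1 : E (j - 1) 0 (j - 1) 0 = E j (s + 1) j (s + 1) :=
      h.diagonal_eq_of_occurs (a := 0) (by unfold Occurs; split_ifs <;> omega) (by omega) (by omega)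
    rw [← e1]
    exact (h.diagonal_eq_of_occurs (a := 0) (by unfold Occurs; split_ifs <;> omega) (by omega)
      (by omega)).symm

theorem diagonal_left_le (h : SliceSystem s p q B K E S) {j k : ℕ} (hj : j ≤ s) (hk : k < q) :
    E j k j k = E (s + 1) (s + 1) (s + 1) (s + 1) := by
  have := h.le_left
  obtain hk' | rfl | hk' := lt_trichotomy k (s + 1)
  · exact h.diagonal_small hj (by omega)
  · exact (h.diagonal_row_col hj).2
  · rw [← h.diagonal_row_large hk' hk]
    exact (h.diagonal_eq_of_occurs (a := j) (by unfold Occurs; split_ifs <;> omega) (by omega)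
      (by omega)).symm

/-- The diagonal of `E` is constant. -/
theorem diagonal (h : SliceSystem s p q B K E S) {j k : ℕ} (hj : j < p) (hk : k < q) :
    E j k j k = E (s + 1) (s + 1) (s + 1) (s + 1) := by
  induction j using Nat.strong_induction_on with
  | _ j ih =>
  have := h.le_left; have := h.le_right; have := h.pos
  obtain hj' | rfl | hj' := lt_trichotomy j (s + 1)
  · exact h.diagonal_left_le (by omega) hk
  · obtain hk' | rfl | hk' := lt_trichotomy k (s + 1)
    · exact (h.diagonal_row_col (by omega)).1
    · rfl
    · exact h.diagonal_row_large hk' hk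
  · obtain hk' | rfl | hk' := lt_trichotomy k (s + 1)
    · rw [← h.diagonal_col_large hj' hj]
      exact (h.diagonal_eq_of_occurs (a := k) (by unfold Occurs; split_ifs <;> omega) (by omega)
        (by omega)).symm
    · exact h.diagonal_col_large hj' hj
    · obtain rfl | hj2 : j = s + 2 ∨ s + 2 < j := by omega
      · rw [← ih 1 (by omega) (by omega)]
        exact (h.diagonal_eq_of_occurs (a := 0) (by unfold Occurs; split_ifs <;> omega) (by omega)
          (by omega)).symm
      · rw [← ih (j - 1) (by omega) (by omega)]
        exact (h.diagonal_eq_of_occurs (a := 0) (by unfold Occurs; split_ifs <;> omega) (by omega)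
          (by omega)).symm

end SliceSystem

end Diagonal

/-! ### From the slice system to local measurements -/

section BasisStates

set_option linter.unusedSectionVars false

variable {ι : Type} [Fintype ι] [DecidableEq ι] {s n p q : ℕ} {e : ι ≃ Fin n × (Fin p × Fin q)}
  {K : ℕ → ℕ → ℕ → EuclideanSpace ℂ ι}

/-- `K a j k` is the computational basis state with coordinates `(a, j, k)` with respect to `e`, and
it is zero out of range. -/
structure IsBasisFamily (e : ι ≃ Fin n × (Fin p × Fin q))
    (K : ℕ → ℕ → ℕ → EuclideanSpace ℂ ι) : Prop where
  eq_single : ∀ a j k (ha : a < n) (hj : j < p) (hk : k < q),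
    K a j k = EuclideanSpace.single (e.symm (⟨a, ha⟩, (⟨j, hj⟩, ⟨k, hk⟩))) 1
  eq_zero : ∀ a j k, ¬(a < n ∧ j < p ∧ k < q) → K a j k = 0

namespace IsBasisFamily

theorem apply_symm (hK : IsBasisFamily e K) (a j k : ℕ) (u : Fin n) (v : Fin p) (w : Fin q) :
    K a j k (e.symm (u, (v, w))) = if a = u ∧ j = v ∧ k = w then 1 else 0 := by
  by_cases h : a < n ∧ j < p ∧ k < q
  · obtain ⟨ha, hj, hk⟩ := h
    rw [hK.eq_single a j k ha hj hk]
    simp only [PiLp.single_apply, EmbeddingLike.apply_eq_iff_eq, Prod.mk.injEq,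
      Fin.ext_iff]
    refine if_congr ?_ rfl rfl
    omega
  · rw [hK.eq_zero a j k h, if_neg (by omega)]
    rfl

/-- In slice `s + 1` the labelled state is the single basis state of its label. -/
theorem labelled_apply (hK : IsBasisFamily e K) (hn : s + 2 ≤ n) (j k : ℕ) (v : Fin p)
    (w : Fin q) : labelled s K j k (e.symm (⟨s + 1, by omega⟩, (v, w))) =
      if j = v ∧ k = w then 1 else 0 := by
  have h : tail s K j k (e.symm (⟨s + 1, by omega⟩, (v, w))) = 0 := by
    generalize hz : e.symm (⟨s + 1, by omega⟩, (v, w)) = z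
    refine Submodule.span_induction (p := fun u _ => u.ofLp z = 0) ?_ rfl
      (fun x y _ _ hx hy => by rw [PiLp.add_apply, hx, hy, add_zero])
      (fun c x _ hx => by rw [PiLp.smul_apply, hx, smul_zero]) (tail_mem_span s K j k)
    rintro _ ⟨a, x, y, ho, rfl⟩
    have := ho.slice_le
    rw [← hz, hK.apply_symm, if_neg]
    simp only
    omega
  rw [labelled, PiLp.add_apply, h, hK.apply_symm, add_zero]
  simp

theorem labelled_inner_eq_zero (hK : IsBasisFamily e K) (hs : 1 ≤ s) {j k j' k' : ℕ}
    (hne : ¬(j = j' ∧ k = k')) : inner ℂ (labelled s K j k) (labelled s K j' k') = 0 := by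
  have key : ∀ a x y a' x' y', ¬(a = a' ∧ x = x' ∧ y = y') →
      inner ℂ (K a x y) (K a' x' y') = 0 := by
    intro a x y a' x' y' h
    by_cases h1 : a < n ∧ x < p ∧ y < q
    · by_cases h2 : a' < n ∧ x' < p ∧ y' < q
      · rw [hK.eq_single _ _ _ h1.1 h1.2.1 h1.2.2, hK.eq_single _ _ _ h2.1 h2.2.1 h2.2.2,
          EuclideanSpace.inner_single_left, PiLp.single_apply, if_neg, mul_zero]
        simpa [Fin.ext_iff] using h
      · rw [hK.eq_zero _ _ _ h2, inner_zero_right]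
    · rw [hK.eq_zero _ _ _ h1, inner_zero_left]
  have mem : ∀ j k, labelled s K j k ∈ Submodule.span ℂ
      {v | ∃ a x y, (a = s + 1 ∧ x = j ∧ y = k ∨ Occurs s a x y j k) ∧ v = K a x y} := by
    intro j k
    refine Submodule.add_mem _ (Submodule.subset_span ⟨_, _, _, Or.inl ⟨rfl, rfl, rfl⟩, rfl⟩)
      (Submodule.span_mono ?_ (tail_mem_span s K j k))
    rintro _ ⟨a, x, y, ho, rfl⟩
    exact ⟨a, x, y, Or.inr ho, rfl⟩
  refine sesqForm_eq_zero_of_mem_span (innerₛₗ ℂ) ?_ (mem j k) (mem j' k')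
  rintro _ ⟨a, x, y, h, rfl⟩ _ ⟨a', x', y', h', rfl⟩
  refine key _ _ _ _ _ _ ?_
  rintro ⟨rfl, rfl, rfl⟩
  obtain h | h := h <;> obtain h' | h' := h'
  · omega
  · have := h'.slice_le
    omega
  · have := h.slice_le
    omega
  · exact hne (h.unique hs h')

theorem inner_labelled_ones (hK : IsBasisFamily e K) (hs : 1 ≤ s) (hn : s + 2 ≤ n) (hp : s + 2 ≤ p)
    (hq : s + 2 ≤ q) {j k : ℕ} (hj : j < p) (hk : k < q) :
    inner ℂ (WithLp.toLp 2 fun _ => 1) (labelled s K j k) = 0 := by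
  have key : ∀ {a x y}, a < n → x < p → y < q →
      inner ℂ (WithLp.toLp 2 fun _ => 1) (K a x y) = 1 := by
    intro a x y ha hx hy
    rw [hK.eq_single _ _ _ ha hx hy, EuclideanSpace.inner_single_right]
    simp
  have hocc : ∀ {a x y}, Occurs s a x y j k →
      inner ℂ (WithLp.toLp 2 fun _ => 1) (K a x y) = 1 := by
    intro a x y ho
    have h1 := ho.lt hs hp hq hj hk
    have h2 := ho.slice_le
    exact key (by omega) h1.1 h1.2
  rw [labelled, inner_add_right, key (by omega) hj hk]
  obtain ⟨b, u, v, ht, ho, -⟩ | ⟨b, u, v, b', u', v', ht, ho, ho', -⟩ :=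
    tail_eq_neg_or_eq_add s K j k
  · rw [ht, inner_neg_right, hocc ho, add_neg_cancel]
  · rw [ht, inner_add_right, inner_smul_right, inner_smul_right, hocc ho, hocc ho', mul_one,
      mul_one, one_add_ω₃_add]

/-- A party with computational basis `{(j, k) : j < p, k < q}` can perform only trivial
orthogonality-preserving measurements on an orthogonal set that contains the stopper state and, up
to scalars, all the labelled states. -/
theorem onlyTrivialOPLM (hK : IsBasisFamily e K) (hs : 1 ≤ s) (hn : s + 2 ≤ n) (hp : s + 2 ≤ p)
    (hq : s + 2 ≤ q) {T : Set (EuclideanSpace ℂ ι)}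
    (hones : (WithLp.toLp 2 fun _ => 1 : EuclideanSpace ℂ ι) ∈ T)
    (hlab : ∀ j k, j < p → k < q → ∃ c : ℂ, ∃ φ ∈ T, labelled s K j k = c • φ) :
    OnlyTrivialOPLM e T := by
  intro r M _ hpres m
  set G := (M m)ᴴ * M m with hG
  have hGherm : G.IsHermitian := Matrix.isHermitian_conjTranspose_mul_self _
  have hform : T.Pairwise fun Φ Ψ => localForm e G Φ Ψ = 0 := by
    intro Φ hΦ Ψ hΨ hne
    show localForm e G Φ Ψ = 0
    rw [hG, ← inner_applyLocal]
    exact hpres m hΦ hΨ hne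
  let E : ℕ → ℕ → ℕ → ℕ → ℂ := fun j k j' k' =>
    if h : (j < p ∧ k < q) ∧ j' < p ∧ k' < q then
      G (⟨j, h.1.1⟩, ⟨k, h.1.2⟩) (⟨j', h.2.1⟩, ⟨k', h.2.2⟩) else 0
  have hsys : SliceSystem s p q (localForm e G) K E (WithLp.toLp 2 fun _ => 1) :=
    { pos := hs
      le_left := hp
      le_right := hq
      form_same := by
        intro a j k j' k' ha
        by_cases h1 : j < p ∧ k < q
        · by_cases h2 : j' < p ∧ k' < q
          · rw [hK.eq_single a j k (by omega) h1.1 h1.2, hK.eq_single a j' k' (by omega) h2.1 h2.2,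
              localForm_single]
            simp [E, h1, h2]
          · rw [hK.eq_zero a j' k' (by omega), map_zero]
            simp only [E]
            rw [dif_neg (by omega)]
        · rw [hK.eq_zero a j k (by omega), map_zero]
          simp only [E]
          rw [dif_neg (by omega)]
          rfl
      form_ne := by
        intro a j k a' j' k' hne
        by_cases h1 : a < n ∧ j < p ∧ k < q
        · by_cases h2 : a' < n ∧ j' < p ∧ k' < q
          · rw [hK.eq_single a j k h1.1 h1.2.1 h1.2.2, hK.eq_single a' j' k' h2.1 h2.2.1 h2.2.2,
              localForm_single, if_neg]
            simpa [Fin.ext_iff] using hne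
          · rw [hK.eq_zero a' j' k' h2, map_zero]
        · rw [hK.eq_zero a j k h1, map_zero]
          rfl
      herm := by
        intro j k j' k'
        by_cases h1 : (j < p ∧ k < q) ∧ j' < p ∧ k' < q
        · simp only [E]
          rw [dif_pos h1, dif_pos h1.symm]
          exact (hGherm.apply _ _).symm
        · simp only [E]
          rw [dif_neg h1, dif_neg (by omega), map_zero]
      pair := by
        intro j k j' k' hj hk hj' hk' hne
        obtain ⟨c, φ, hφ, h1⟩ := hlab j k hj hk
        obtain ⟨c', φ', hφ', h2⟩ := hlab j' k' hj' hk'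
        -- The states of different labels differ even up to scalars, as slice `s + 1` shows.
        have hne' : φ ≠ φ' := by
          rintro rfl
          have a1 := hK.labelled_apply hn j k ⟨j, hj⟩ ⟨k, hk⟩
          have a2 := hK.labelled_apply hn j k ⟨j', hj'⟩ ⟨k', hk'⟩
          have a3 := hK.labelled_apply hn j' k' ⟨j', hj'⟩ ⟨k', hk'⟩
          rw [h1, PiLp.smul_apply, smul_eq_mul] at a1 a2
          rw [h2, PiLp.smul_apply, smul_eq_mul, if_pos ⟨rfl, rfl⟩] at a3
          rw [if_neg hne] at a2
          rw [if_pos ⟨rfl, rfl⟩] at a1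
          rcases mul_eq_zero.mp a2 with h0 | h0
          · rw [h0, zero_mul] at a1
            exact zero_ne_one a1
          · rw [h0, mul_zero] at a3
            exact zero_ne_one a3
        have h0 : localForm e G φ φ' = 0 := hform hφ hφ' hne'
        rw [h1, h2, map_smul, LinearMap.map_smulₛₗ, LinearMap.smul_apply, h0, smul_zero, smul_zero]
      row := by
        intro a j k ha hj hk
        rw [hK.eq_single a j k (by omega) hj hk, localForm_single_one, Finset.sum_product,
          Fintype.sum_prod_type, Finset.sum_range]
        refine Finset.sum_congr rfl fun x _ => ?_
        rw [Finset.sum_range]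
        refine Finset.sum_congr rfl fun y _ => ?_
        simp [E, hj, hk]
      form_labelled_stopper := by
        intro j k hj hk
        obtain ⟨c, φ, hφ, h1⟩ := hlab j k hj hk
        have hne : φ ≠ WithLp.toLp 2 fun _ => 1 := by
          rintro rfl
          obtain ⟨j', hj', hjj⟩ : ∃ j', j' < p ∧ j ≠ j' := by
            by_cases h0 : j = 0
            · exact ⟨1, by omega, by omega⟩
            · exact ⟨0, by omega, by omega⟩
          have a1 := hK.labelled_apply hn j k ⟨j, hj⟩ ⟨k, hk⟩
          have a2 := hK.labelled_apply hn j k ⟨j', hj'⟩ ⟨k, hk⟩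
          rw [h1, PiLp.smul_apply, if_pos ⟨rfl, rfl⟩] at a1
          rw [h1, PiLp.smul_apply, if_neg (by simp only; omega)] at a2
          exact zero_ne_one (a2.symm.trans a1)
        have h0 : localForm e G φ (WithLp.toLp 2 fun _ => 1) = 0 := hform hφ hones hne
        rw [h1, LinearMap.map_smulₛₗ, LinearMap.smul_apply, h0, smul_zero] }
  refine ⟨E (s + 1) (s + 1) (s + 1) (s + 1), ?_⟩
  ext ⟨⟨j, hj⟩, ⟨k, hk⟩⟩ ⟨⟨j', hj'⟩, ⟨k', hk'⟩⟩
  have hE : G (⟨j, hj⟩, ⟨k, hk⟩) (⟨j', hj'⟩, ⟨k', hk'⟩) = E j k j' k' := by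
    simp only [E]
    rw [dif_pos ⟨⟨hj, hk⟩, hj', hk'⟩]
  rw [hE, Matrix.smul_apply, Matrix.one_apply]
  by_cases heq : j = j' ∧ k = k'
  · obtain ⟨rfl, rfl⟩ := heq
    simpa using hsys.diagonal hj hk
  · rw [hsys.off_diagonal hj hk hj' hk' heq, if_neg, smul_zero]
    simpa [Fin.ext_iff] using heq

end IsBasisFamily

end BasisStates

section NonlocalSet

variable {d₁ d₂ d₃ : ℕ}

theorem ket_eq_single {i j k : ℕ} (hi : i < d₁) (hj : j < d₂) (hk : k < d₃) :
    ket d₁ d₂ d₃ i j k = EuclideanSpace.single (⟨i, hi⟩, (⟨j, hj⟩, ⟨k, hk⟩)) 1 := by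
  ext ⟨x, y, z⟩
  simp [ket, Fin.ext_iff]

theorem ket_eq_zero {i j k : ℕ} (h : ¬(i < d₁ ∧ j < d₂ ∧ k < d₃)) : ket d₁ d₂ d₃ i j k = 0 := by
  ext ⟨⟨x, hx⟩, ⟨y, hy⟩, ⟨z, hz⟩⟩
  simp only [ket, PiLp.zero_apply]
  rw [if_neg (by omega)]

theorem stopper_eq : stopper d₁ d₂ d₃ = WithLp.toLp 2 fun _ => 1 := by
  ext ⟨x, y, z⟩
  simp only [stopper, WithLp.ofLp_sum, Finset.sum_apply, ket, ← Fin.ext_iff, ite_and]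
  simp

theorem isBasisFamily_splitA : IsBasisFamily (splitA d₁ d₂ d₃) (ket d₁ d₂ d₃) where
  eq_single _ _ _ ha hj hk := ket_eq_single ha hj hk
  eq_zero _ _ _ h := ket_eq_zero h

theorem isBasisFamily_splitB :
    IsBasisFamily (splitB d₁ d₂ d₃) (fun b c a => ket d₁ d₂ d₃ a b c) where
  eq_single _ _ _ hb hc ha := ket_eq_single ha hb hc
  eq_zero _ _ _ h := ket_eq_zero (by omega)

theorem isBasisFamily_splitC :
    IsBasisFamily (splitC d₁ d₂ d₃) (fun c a b => ket d₁ d₂ d₃ a b c) where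
  eq_single _ _ _ hc ha hb := ket_eq_single ha hb hc
  eq_zero _ _ _ h := ket_eq_zero (by omega)

end NonlocalSet

/-! ### The set of states and its cardinality -/

section Main

variable {s d₂ d₃ : ℕ}

theorem labelled_mem_nonlocalSet (h₂ : s + 2 ≤ d₂) {j k : ℕ} (hj : j < d₂)
    (hk : k < d₃) :
    labelled s (ket (s + 2) d₂ d₃) j k ∈ nonlocalSet (s + 2) d₂ d₃ := by
  simp only [nonlocalSet, Set.mem_union]
  unfold labelled tail
  split_ifs with h1 h2 h3 h3 h4 h5 h6 h7 h8
  · have : ket (s + 2) d₂ d₃ (s + 1) j k + -ket (s + 2) d₂ d₃ k (s + 1) (s + 1) ∈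
        A3 (s + 2) d₂ d₃ := by
      refine ⟨k, h2, ?_⟩
      rw [show s + 2 - 2 - k = j by omega, ← sub_eq_add_neg]
      rfl
    tauto
  · by_cases h4 : s + 1 ≤ j + k
    · have : ket (s + 2) d₂ d₃ (s + 1) j k + (ω₃ • ket (s + 2) d₂ d₃ j k (s + 1) +
          ω₃ ^ 2 • ket (s + 2) d₂ d₃ k (s + 1) j) ∈ A4 (s + 2) d₂ d₃ :=
        ⟨j, h1, k, h2, h4, by rw [wLike, ← add_assoc]; rfl⟩
      tauto
    · have : ket (s + 2) d₂ d₃ (s + 1) j k + (ω₃ • ket (s + 2) d₂ d₃ j k (s + 1) +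
          ω₃ ^ 2 • ket (s + 2) d₂ d₃ k (s + 1) j) ∈ A5 (s + 2) d₂ d₃ :=
        ⟨j, h1, k, h2, by omega, by rw [wLike, ← add_assoc]; rfl⟩
      tauto
  · have : ket (s + 2) d₂ d₃ (s + 1) j k + -ket (s + 2) d₂ d₃ j (s + 1) (s - j) ∈
        A2 (s + 2) d₂ d₃ := ⟨j, h1, by rw [h3, ← sub_eq_add_neg]; rfl⟩
    tauto
  · have : ket (s + 2) d₂ d₃ (s + 1) j k + -ket (s + 2) d₂ d₃ j (s + 1) k ∈
        A6 (s + 2) d₂ d₃ :=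
      ⟨j, h1, k - (s + 2), by omega, by
        rw [show s + 2 + (k - (s + 2)) = k by omega, ← sub_eq_add_neg]; rfl⟩
    tauto
  · have : ket (s + 2) d₂ d₃ (s + 1) j k + -ket (s + 2) d₂ d₃ (s - k) k (s + 1) ∈
        A1 (s + 2) d₂ d₃ := ⟨k, h5, by rw [h4, ← sub_eq_add_neg]; rfl⟩
    tauto
  · have : ket (s + 2) d₂ d₃ (s + 1) j k + -ket (s + 2) d₂ d₃ s s s ∈ A0 (s + 2) d₂ d₃ := by
      rw [h4, h6, ← sub_eq_add_neg]
      rfl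
    tauto
  · by_cases h7 : k = s + 2
    · have : ket (s + 2) d₂ d₃ (s + 1) j k + -ket (s + 2) d₂ d₃ 0 0 (shift s k) ∈
          A7 (s + 2) d₂ d₃ := by
        refine ⟨by omega, ?_⟩
        rw [shift, if_pos h7, h4, h7, ← sub_eq_add_neg]
        rfl
      tauto
    · have : ket (s + 2) d₂ d₃ (s + 1) j k + -ket (s + 2) d₂ d₃ 0 0 (shift s k) ∈
          A8 (s + 2) d₂ d₃ := by
        refine ⟨k - (s + 3), by omega, ?_⟩
        rw [shift, if_neg h7, h4, show s + 2 + 1 + (k - (s + 3)) = k by omega,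
          show s + 2 + (k - (s + 3)) = k - 1 by omega, ← sub_eq_add_neg]
        rfl
      tauto
  · have : ket (s + 2) d₂ d₃ (s + 1) j k + -ket (s + 2) d₂ d₃ k j (s + 1) ∈
        A9 (s + 2) d₂ d₃ :=
      ⟨k, by omega, j - (s + 2), by omega, by
        rw [show s + 2 + (j - (s + 2)) = j by omega, ← sub_eq_add_neg]; rfl⟩
    tauto
  · by_cases h7 : j = s + 2
    · have : ket (s + 2) d₂ d₃ (s + 1) j k + -ket (s + 2) d₂ d₃ 0 (shift s j) 0 ∈
          A10 (s + 2) d₂ d₃ := by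
        refine ⟨by omega, ?_⟩
        rw [shift, if_pos h7, h8, h7, ← sub_eq_add_neg]
        rfl
      tauto
    · have : ket (s + 2) d₂ d₃ (s + 1) j k + -ket (s + 2) d₂ d₃ 0 (shift s j) 0 ∈
          A11 (s + 2) d₂ d₃ := by
        refine ⟨j - (s + 3), by omega, ?_⟩
        rw [shift, if_neg h7, h8, show s + 2 + 1 + (j - (s + 3)) = j by omega,
          show s + 2 + (j - (s + 3)) = j - 1 by omega, ← sub_eq_add_neg]
        rfl
      tauto
  · by_cases h7 : j = s + 2
    · have : ket (s + 2) d₂ d₃ (s + 1) j k + -ket (s + 2) d₂ d₃ 0 (shift s j) k ∈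
          A12 (s + 2) d₂ d₃ := by
        refine ⟨by omega, k - (s + 2), by omega, ?_⟩
        rw [shift, if_pos h7, h7, show s + 2 + (k - (s + 2)) = k by omega, ← sub_eq_add_neg]
        rfl
      tauto
    · have : ket (s + 2) d₂ d₃ (s + 1) j k + -ket (s + 2) d₂ d₃ 0 (shift s j) k ∈
          A13 (s + 2) d₂ d₃ := by
        refine ⟨j - (s + 3), by omega, k - (s + 2), by omega, ?_⟩
        rw [shift, if_neg h7, show s + 2 + 1 + (j - (s + 3)) = j by omega,
          show s + 2 + (j - (s + 3)) = j - 1 by omega,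
          show s + 2 + (k - (s + 2)) = k by omega, ← sub_eq_add_neg]
        rfl
      tauto

theorem eq_labelled_of_mem_nonlocalSet (hs : 1 ≤ s) (h₂ : s + 2 ≤ d₂) (h₃ : s + 2 ≤ d₃)
    {φ : H (s + 2) d₂ d₃} (hφ : φ ∈ nonlocalSet (s + 2) d₂ d₃) :
    φ = stopper (s + 2) d₂ d₃ ∨
      ∃ j k, j < d₂ ∧ k < d₃ ∧ φ = labelled s (ket (s + 2) d₂ d₃) j k := by
  have hm1 : s + 2 - 1 = s + 1 := rfl
  have hm2 : s + 2 - 2 = s := rfl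
  rcases hφ with ((((((((((((((h | h) | h) | h) | h) | h) | h) | h) | h) | h) | h) | h) | h) | h) | h)
  · refine Or.inr ⟨s + 1, s + 1, by omega, by omega, h.trans ?_⟩
    simp [labelled, tail, sub_eq_add_neg]
  · obtain ⟨i, hi, rfl⟩ := h
    rw [hm1] at hi
    refine Or.inr ⟨s + 1, i, by omega, by omega, ?_⟩
    simp [labelled, tail, sub_eq_add_neg, hi]
  · obtain ⟨i, hi, rfl⟩ := h
    rw [hm1] at hi
    refine Or.inr ⟨i, s + 1, by omega, by omega, ?_⟩
    simp [labelled, tail, sub_eq_add_neg, hi]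
  · obtain ⟨i, hi, rfl⟩ := h
    rw [hm1] at hi
    refine Or.inr ⟨s - i, i, by omega, by omega, ?_⟩
    rw [labelled, tail, if_pos (by omega), if_pos hi, if_pos (by omega), hm1, hm2, sub_eq_add_neg]
  · obtain ⟨k, hk, l, hl, hkl, rfl⟩ := h
    rw [hm1] at hk hl hkl
    refine Or.inr ⟨k, l, by omega, by omega, ?_⟩
    rw [labelled, tail, if_pos hk, if_pos hl, if_neg (by omega), wLike, hm1, add_assoc]
  · obtain ⟨k, hk, l, hl, hkl, rfl⟩ := h
    rw [hm1] at hk hl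
    refine Or.inr ⟨k, l, by omega, by omega, ?_⟩
    rw [labelled, tail, if_pos hk, if_pos hl, if_neg (by omega), wLike, hm1, add_assoc]
  · obtain ⟨i, hi, j, hj, rfl⟩ := h
    rw [hm1] at hi
    refine Or.inr ⟨i, s + 2 + j, by omega, by omega, ?_⟩
    rw [labelled, tail, if_pos hi, if_neg (by omega), if_neg (by omega), hm1, sub_eq_add_neg]
  · obtain ⟨hd, rfl⟩ := h
    refine Or.inr ⟨s + 1, s + 2, by omega, by omega, ?_⟩
    simp [labelled, tail, shift, sub_eq_add_neg]
  · obtain ⟨i, hi, rfl⟩ := h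
    refine Or.inr ⟨s + 1, s + 2 + 1 + i, by omega, by omega, ?_⟩
    rw [labelled, tail, if_neg (by omega), if_pos rfl, if_neg (by omega), if_neg (by omega), shift,
      if_neg (by omega), hm1, show s + 2 + 1 + i - 1 = s + 2 + i by omega, sub_eq_add_neg]
  · obtain ⟨i, hi, j, hj, rfl⟩ := h
    rw [hm1] at hi
    refine Or.inr ⟨s + 2 + j, i, by omega, by omega, ?_⟩
    rw [labelled, tail, if_neg (by omega), if_neg (by omega), if_pos hi, hm1, sub_eq_add_neg]
  · obtain ⟨hd, rfl⟩ := h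
    refine Or.inr ⟨s + 2, s + 1, by omega, by omega, ?_⟩
    simp [labelled, tail, shift, sub_eq_add_neg]
  · obtain ⟨i, hi, rfl⟩ := h
    refine Or.inr ⟨s + 2 + 1 + i, s + 1, by omega, by omega, ?_⟩
    rw [labelled, tail, if_neg (by omega), if_neg (by omega), if_neg (by omega), if_pos rfl, shift,
      if_neg (by omega), hm1, show s + 2 + 1 + i - 1 = s + 2 + i by omega, sub_eq_add_neg]
  · obtain ⟨hd, i, hi, rfl⟩ := h
    refine Or.inr ⟨s + 2, s + 2 + i, by omega, by omega, ?_⟩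
    rw [labelled, tail, if_neg (by omega), if_neg (by omega), if_neg (by omega),
      if_neg (by omega), shift, if_pos rfl, hm1, sub_eq_add_neg]
  · obtain ⟨i, hi, j, hj, rfl⟩ := h
    refine Or.inr ⟨s + 2 + 1 + i, s + 2 + j, by omega, by omega, ?_⟩
    rw [labelled, tail, if_neg (by omega), if_neg (by omega), if_neg (by omega),
      if_neg (by omega), shift, if_neg (by omega), hm1,
      show s + 2 + 1 + i - 1 = s + 2 + i by omega, sub_eq_add_neg]
  · exact Or.inl h

/-- The members of `nonlocalSet` other than the stopper are labelled by the basis states of `BC`. -/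
theorem nonlocalSet_eq (hs : 1 ≤ s) (h₂ : s + 2 ≤ d₂) (h₃ : s + 2 ≤ d₃) :
    nonlocalSet (s + 2) d₂ d₃ = insert (stopper (s + 2) d₂ d₃)
      (Set.range fun y : Fin d₂ × Fin d₃ => labelled s (ket (s + 2) d₂ d₃) y.1 y.2) := by
  ext φ
  constructor
  · intro hφ
    obtain h | ⟨j, k, hj, hk, h⟩ := eq_labelled_of_mem_nonlocalSet hs h₂ h₃ hφ
    · exact Or.inl h
    · exact Or.inr ⟨(⟨j, hj⟩, ⟨k, hk⟩), h.symm⟩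
  · rintro (rfl | ⟨y, rfl⟩)
    · exact Or.inr rfl
    · exact labelled_mem_nonlocalSet h₂ y.1.2 y.2.2

theorem labelled_ne_zero (j : Fin d₂) (k : Fin d₃) :
    labelled s (ket (s + 2) d₂ d₃) j k ≠ 0 := by
  intro h
  have := isBasisFamily_splitA.labelled_apply (le_refl (s + 2)) j k j k
  rw [h, if_pos ⟨rfl, rfl⟩] at this
  exact zero_ne_one this

theorem inner_labelled_stopper (hs : 1 ≤ s) (h₂ : s + 2 ≤ d₂) (h₃ : s + 2 ≤ d₃)
    (j : Fin d₂) (k : Fin d₃) :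
    inner ℂ (stopper (s + 2) d₂ d₃) (labelled s (ket (s + 2) d₂ d₃) j k) = 0 := by
  rw [stopper_eq]
  exact isBasisFamily_splitA.inner_labelled_ones hs le_rfl h₂ h₃ j.2 k.2

theorem isOrthogonalSet_nonlocalSet (hs : 1 ≤ s) (h₂ : s + 2 ≤ d₂) (h₃ : s + 2 ≤ d₃) :
    IsOrthogonalSet (nonlocalSet (s + 2) d₂ d₃) := by
  rw [nonlocalSet_eq hs h₂ h₃]
  constructor
  · rintro (h | ⟨y, h⟩)
    · have h0 := congrArg
        (fun φ : H (s + 2) d₂ d₃ => φ (⟨0, by omega⟩, (⟨0, by omega⟩, ⟨0, by omega⟩))) h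
      rw [stopper_eq] at h0
      exact zero_ne_one h0
    · exact labelled_ne_zero _ _ h
  · rintro φ hφ ψ hψ hne
    obtain rfl | ⟨y, rfl⟩ := hφ <;> obtain rfl | ⟨z, rfl⟩ := hψ
    · exact absurd rfl hne
    · exact inner_labelled_stopper hs h₂ h₃ _ _
    · exact inner_eq_zero_symm.mp (inner_labelled_stopper hs h₂ h₃ _ _)
    · refine isBasisFamily_splitA.labelled_inner_eq_zero hs ?_
      rintro ⟨h1, h2⟩
      exact hne (by simp only [h1, h2])

theorem ncard_nonlocalSet (hs : 1 ≤ s) (h₂ : s + 2 ≤ d₂) (h₃ : s + 2 ≤ d₃) :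
    (nonlocalSet (s + 2) d₂ d₃).ncard = d₂ * d₃ + 1 := by
  rw [nonlocalSet_eq hs h₂ h₃, Set.ncard_insert_of_notMem, Set.ncard_range_of_injective]
  · simp
  · rintro ⟨j, k⟩ ⟨j', k'⟩ h
    have h1 := isBasisFamily_splitA.labelled_apply (le_refl (s + 2)) j k j k
    have h2 := isBasisFamily_splitA.labelled_apply (le_refl (s + 2)) j' k' j k
    simp only at h
    rw [h, h2, if_pos (And.intro rfl rfl)] at h1
    by_contra hne
    rw [if_neg] at h1
    · exact zero_ne_one h1
    · rintro ⟨h3, h4⟩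
      exact hne (Prod.ext (Fin.ext h3.symm) (Fin.ext h4.symm))
  · rintro ⟨y, h⟩
    have h0 := inner_labelled_stopper hs h₂ h₃ y.1 y.2
    rw [← h] at h0
    exact labelled_ne_zero _ _ (inner_self_eq_zero.mp h0)

/-- The large parties `BC`, `CA`, `AB` see the same labelled states up to the scalars `-1`, `ω₃`,
`ω₃ ^ 2`; the parties `A`, `B`, `C` are parts of `AB`, `BC`, `CA`. -/
theorem strongestNonlocal_nonlocalSet (hs : 1 ≤ s) (h₂ : s + 2 ≤ d₂) (h₂₃ : d₂ ≤ d₃) :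
    StrongestNonlocal (nonlocalSet (s + 2) d₂ d₃) := by
  have h₃ := h₂.trans h₂₃
  have hones : (WithLp.toLp 2 fun _ => 1 : H (s + 2) d₂ d₃) ∈ nonlocalSet (s + 2) d₂ d₃ :=
    Or.inr stopper_eq.symm
  have hw : ω₃ ^ 2 * ω₃ = 1 := by rw [← pow_succ, ω₃_pow_three]
  have hw' : ω₃ * ω₃ ^ 2 = 1 := by rw [mul_comm, hw]
  have hA : OnlyTrivialOPLM (splitA (s + 2) d₂ d₃) (nonlocalSet (s + 2) d₂ d₃) :=
    isBasisFamily_splitA.onlyTrivialOPLM hs le_rfl h₂ h₃ hones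
      fun j k hj hk => ⟨1, _, labelled_mem_nonlocalSet h₂ hj hk, (one_smul _ _).symm⟩
  have hB : OnlyTrivialOPLM (splitB (s + 2) d₂ d₃) (nonlocalSet (s + 2) d₂ d₃) := by
    refine isBasisFamily_splitB.onlyTrivialOPLM hs h₂ h₃ le_rfl hones fun j k hj hk => ?_
    have mem := fun {x y} => labelled_mem_nonlocalSet (s := s) (d₃ := d₃) (j := x) (k := y) h₂
    by_cases h1 : j < s + 1
    · by_cases h2 : k < s + 1
      · by_cases h3 : j + k = s
        · refine ⟨-1, _, mem (x := k) (y := s + 1) (by omega) (by omega), ?_⟩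
          simp [labelled, tail, h2, h1, h3, show s - k = j by omega, add_comm]
        · refine ⟨ω₃, _, mem (x := j) (y := k) (by omega) (by omega), ?_⟩
          simp only [labelled, tail, h1, h2, h3, if_true, if_false, smul_add, smul_smul, hw']
          rw [one_smul, ← pow_two]
          abel
      · refine ⟨1, _, mem (x := s + 1) (y := j) (by omega) (by omega), ?_⟩
        obtain rfl : k = s + 1 := by omega
        simp [labelled, tail, h1]
    · obtain rfl | h2 : j = s + 1 ∨ s + 1 < j := by omega
      · by_cases h3 : k < s + 1
        · refine ⟨-1, _, mem (x := s - k) (y := k) (by omega) (by omega), ?_⟩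
          simp [labelled, tail, h3, show s - k < s + 1 by omega, show s - k + k = s by omega,
            add_comm]
        · refine ⟨1, _, mem (x := s + 1) (y := s + 1) (by omega) (by omega), ?_⟩
          obtain rfl : k = s + 1 := by omega
          simp [labelled, tail]
      · by_cases h3 : k < s + 1
        · refine ⟨-1, _, mem (x := k) (y := j) (by omega) (by omega), ?_⟩
          simp [labelled, tail, h1, h3, h2.ne', add_comm]
        · refine ⟨1, _, mem (x := s + 1) (y := j) (by omega) (by omega), ?_⟩
          obtain rfl : k = s + 1 := by omega
          simp [labelled, tail, h1, h2.ne']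
  have hC : OnlyTrivialOPLM (splitC (s + 2) d₂ d₃) (nonlocalSet (s + 2) d₂ d₃) := by
    refine isBasisFamily_splitC.onlyTrivialOPLM hs h₃ le_rfl h₂ hones fun j k hj hk => ?_
    have mem := fun {x y} => labelled_mem_nonlocalSet (s := s) (d₃ := d₃) (j := x) (k := y) h₂
    by_cases h1 : j < s + 1
    · by_cases h2 : k < s + 1
      · by_cases h3 : j + k = s
        · refine ⟨-1, _, mem (x := s + 1) (y := k) (by omega) (by omega), ?_⟩
          simp [labelled, tail, h2, h1, h3, show s - k = j by omega, add_comm]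
        · refine ⟨ω₃ ^ 2, _, mem (x := j) (y := k) (by omega) (by omega), ?_⟩
          simp only [labelled, tail, h1, h2, h3, if_true, if_false, smul_add, smul_smul, hw]
          rw [one_smul, pow_two ω₃, mul_assoc, ← pow_two, hw', mul_one]
          abel
      · obtain rfl | h3 : k = s + 1 ∨ s + 1 < k := by omega
        · refine ⟨-1, _, mem (x := s - j) (y := j) (by omega) (by omega), ?_⟩
          simp [labelled, tail, h1, show s - j < s + 1 by omega, show s - j + j = s by omega,
            add_comm]
        · refine ⟨-1, _, mem (x := k) (y := j) (by omega) (by omega), ?_⟩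
          simp [labelled, tail, h1, h2, h3.ne', add_comm]
    · obtain rfl : j = s + 1 := by omega
      by_cases h2 : k < s + 1
      · refine ⟨1, _, mem (x := k) (y := s + 1) (by omega) (by omega), ?_⟩
        simp [labelled, tail, h2]
      · obtain rfl | h3 : k = s + 1 ∨ s + 1 < k := by omega
        · refine ⟨1, _, mem (x := s + 1) (y := s + 1) (by omega) (by omega), ?_⟩
          simp [labelled, tail]
        · refine ⟨1, _, mem (x := k) (y := s + 1) (by omega) (by omega), ?_⟩
          simp [labelled, tail, h2, h3.ne']
  have : Nonempty (Fin (s + 2)) := ⟨⟨0, by omega⟩⟩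
  have : Nonempty (Fin d₂) := ⟨⟨0, by omega⟩⟩
  have : Nonempty (Fin d₃) := ⟨⟨0, by omega⟩⟩
  refine ⟨isOrthogonalSet_nonlocalSet hs h₂ h₃, ⟨hA, ?_⟩, ⟨hB, ?_⟩, ⟨hC, ?_⟩⟩
  · refine hC.of_prod _ _ (fun t => rfl) fun t u => ?_
    simp [splitA, splitC, Prod.ext_iff, and_comm]
  · refine hA.of_prod _ _ (fun t => rfl) fun t u => ?_
    simp [splitA, splitB, Prod.ext_iff, and_comm]
  · refine hB.of_prod _ _ (fun t => rfl) fun t u => ?_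
    simp [splitB, splitC, Prod.ext_iff, and_comm]

theorem StrongestNonlocal.le_encard {d₁ d₂ d₃ : ℕ} (h₂ : 2 ≤ d₂) (h₃ : 1 ≤ d₃)
    {T : Set (H d₁ d₂ d₃)} (hT : StrongestNonlocal T) : ((d₂ * d₃ + 1 : ℕ) : ℕ∞) ≤ T.encard := by
  have hcard : Fintype.card (Fin d₂ × Fin d₃) = d₂ * d₃ := by simp
  rw [← hcard]
  refine hT.2.1.1.card_add_one_le_encard hT.1 ?_
  rw [hcard]
  exact le_mul_of_le_of_one_le h₂ h₃

end Main

end Tripartite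

theorem theorem2 (d₁ d₂ d₃ : ℕ) (h₁ : 3 ≤ d₁) (h₁₂ : d₁ ≤ d₂) (h₂₃ : d₂ ≤ d₃) :
    (Tripartite.nonlocalSet d₁ d₂ d₃).ncard = d₂ * d₃ + 1 ∧
    Tripartite.StrongestNonlocal (Tripartite.nonlocalSet d₁ d₂ d₃) ∧
    d₂ * d₃ + 1 = max (d₂ * d₃) (max (d₁ * d₃) (d₁ * d₂)) + 1 ∧
    IsLeast {n : ℕ∞ | ∃ T : Set (Tripartite.H d₁ d₂ d₃),
        Tripartite.StrongestNonlocal T ∧ T.encard = n}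
      ((max (d₂ * d₃) (max (d₁ * d₃) (d₁ * d₂)) + 1 : ℕ) : ℕ∞) := by
  have hmax : max (d₂ * d₃) (max (d₁ * d₃) (d₁ * d₂)) = d₂ * d₃ :=
    max_eq_left (max_le (Nat.mul_le_mul_right _ h₁₂) (Nat.mul_comm d₂ d₃ ▸
      Nat.mul_le_mul (h₁₂.trans h₂₃) le_rfl))
  rw [hmax]
  obtain ⟨s, rfl⟩ : ∃ s, d₁ = s + 2 := ⟨d₁ - 2, by omega⟩
  have hs : 1 ≤ s := by omega
  have hcard := Tripartite.ncard_nonlocalSet hs h₁₂ (h₁₂.trans h₂₃)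
  have hnl := Tripartite.strongestNonlocal_nonlocalSet hs h₁₂ h₂₃
  refine ⟨hcard, hnl, rfl, ⟨_, hnl, ?_⟩, ?_⟩
  · rw [← hcard, Set.Finite.cast_ncard_eq]
    exact Set.finite_of_ncard_ne_zero (by omega)
  · rintro _ ⟨T, hT, rfl⟩
    exact hT.le_encard (by omega) (by omega)
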